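/- Let $\mathcal X=\prod_{i=1}^N\{1,\dots,d_i\}$ be the set of configurations $s=(s_1,\dots,s_N)$ of $N$ discrete variables. An *arithmetic circuit* over $\mathcal X$ is a finite directed acyclic graph whose nodes are of three kinds: leaf input nodes, with value $\mathbb 1[s_i=k]$ for some $i$ and $k$; product nodes, with value $v(s)=\prod_{(u,v)\in E}u(s)$; and weighted-sum nodes, with value $v(s)=\sum_{(u,v)\in E}W_{u,v}\,u(s)$, where the parameters $W_{u,v}$ are complex. It gives the function $f:\mathcal X\to\mathbb C$ computed at a designated output node. A *softplus network* over $\mathcal X$ is a finite directed acyclic graph with input nodes $\mathbb 1[s_i=k]$ without in-edges, in which every other node has the value $v(s)=\sigma\bigl(b_v+\sum_{(u,v)\in E}W_{u,v}\,u(s)\bigr)$ with real parameters and $\sigma(x)=\operatorname{softplus}(x)=\ln(e^x+1)$, except that roots (nodes without out-edges) may instead use the identity $\sigma(x)=x$; two distinct roots are its outputs $g_1,g_2:\mathcal X\to\mathbb R$. In both cases the depth is the maximal length of a directed path ending in an output. There is a universal constant $K>0$ such that the following holds. Let $f:\mathcal X\to\mathbb C$ be given by an arithmetic circuit with $n$ nodes,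 $m$ edges and depth $l$, let $W_{\max}=\max\{1,\max_e|W_e|\}$ (the inner maximum over the edges into weighted-sum nodes), and assume $$f_{\min}:=\inf_{x\in\mathcal X}\min\{|\mathrm{Re} f(x)|,|\mathrm{Im} f(x)|\}>0 .$$ Let $\varepsilon>0$ and put $$c=\ln^2\!\Bigl(\tfrac{m}{\varepsilon'}\ln\tfrac{W_{\max}}{f'}\Bigr)+\ln\!\bigl(\tfrac1{\varepsilon'}\bigr)\sqrt{\tfrac1{\varepsilon'}},\qquad \varepsilon'=\min\{\varepsilon,\tfrac12\},\quad f'=\min\{f_{\min},\tfrac12\}.$$ Then there is a softplus network with at most $K(n+m+c)$ nodes, at most $K(m+c)$ edges and depth at most $K(l\ln m+c)$ whose outputs satisfy $|g_1(x)+i\,g_2(x)-\log f(x)|<\varepsilon$ for all $x\in\mathcal X$, where $\log$ is the principal branch of the complex logarithm. -/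

import Mathlib

open scoped NNReal

noncomputable section

/-- A finite directed acyclic graph with node set `V`; `(u, v) ∈ edges` is an edge from `u` to `v`. -/
structure DAG (V : Type) [Fintype V] where
  edges : Finset (V × V)
  acyclic : ∀ v, ¬ Relation.TransGen (fun u v => (u, v) ∈ edges) v v

namespace DAG

variable {V : Type} [Fintype V] (G : DAG V)

theorem wf : WellFounded (fun u v => (u, v) ∈ G.edges) := by
  have h1 : IsTrans V (Relation.TransGen (fun u v => (u, v) ∈ G.edges)) :=
    ⟨fun _ _ _ => Relation.TransGen.trans⟩
  have h2 : Std.Irrefl (Relation.TransGen (fun u v => (u, v) ∈ G.edges)) := ⟨G.acyclic⟩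
  exact Subrelation.wf (fun h => Relation.TransGen.single h)
    (Finite.wellFounded_of_trans_of_irrefl
      (Relation.TransGen (fun u v => (u, v) ∈ G.edges)))

open Classical in
/-- The in-neighbours of a node. -/
def preds (v : V) : Finset V := Finset.univ.filter fun u => (u, v) ∈ G.edges

theorem mem_preds {u v : V} : u ∈ G.preds v ↔ (u, v) ∈ G.edges := by
  simp [preds]

/-- The maximal length (number of edges) of a directed path that ends at the given node. -/
def height : V → ℕ :=
  G.wf.fix fun v rec =>
    (G.preds v).attach.sup fun u => rec u.1 (G.mem_preds.1 u.2) + 1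

theorem height_eq (v : V) : G.height v = (G.preds v).sup fun u => G.height u + 1 := by
  rw [height, WellFounded.fix_eq]
  exact Finset.sup_attach (G.preds v) fun u => G.height u + 1

/-- A root is a node without outgoing edges. -/
def IsRoot (v : V) : Prop := ∀ w, (v, w) ∉ G.edges

end DAG

/-- Configurations `(s₁, …, s_N)` of `N` discrete degrees of freedom, the `i`-th of which
takes `d i` values. -/
abbrev Config {N : ℕ} (d : Fin N → ℕ) : Type := (i : Fin N) → Fin (d i)

/-- The kinds of nodes of an arithmetic circuit: the input leaf `𝟙[s_i = k]`, a product node,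
a weighted-sum node. -/
inductive NodeKind {N : ℕ} (d : Fin N → ℕ) : Type
  | input (i : Fin N) (k : Fin (d i))
  | prod
  | sum

/-- An arithmetic circuit with complex parameters. `weight u v` is the parameter of the edge
`(u, v)`; it is used only if `(u, v)` is an edge into a weighted-sum node. -/
structure ArithCircuit {N : ℕ} (d : Fin N → ℕ) (V : Type) [Fintype V] extends DAG V where
  kind : V → NodeKind d
  input_leaf : ∀ u v i k, kind v = NodeKind.input i k → (u, v) ∉ edges
  weight : V → V → ℂ
  out : V

namespace ArithCircuit

variable {N : ℕ} {d : Fin N → ℕ} {V : Type} [Fintype V] (C : ArithCircuit d V)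

/-- The value of a node at the configuration `s`. -/
def value (s : Config d) : V → ℂ :=
  C.wf.fix fun v rec =>
    match C.kind v with
    | .input i k => if s i = k then 1 else 0
    | .prod => ∏ u ∈ (C.preds v).attach, rec u.1 (C.mem_preds.1 u.2)
    | .sum => ∑ u ∈ (C.preds v).attach, C.weight u.1 v * rec u.1 (C.mem_preds.1 u.2)

theorem value_eq (s : Config d) (v : V) :
    C.value s v =
      match C.kind v with
      | .input i k => if s i = k then 1 else 0
      | .prod => ∏ u ∈ C.preds v, C.value s u
      | .sum => ∑ u ∈ C.preds v, C.weight u v * C.value s u := by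
  rw [value, WellFounded.fix_eq]
  cases C.kind v with
  | input i k => rfl
  | prod => exact Finset.prod_attach (C.preds v) fun u => C.value s u
  | sum => exact Finset.sum_attach (C.preds v) fun u => C.weight u v * C.value s u

/-- The function given by the circuit. -/
def eval (s : Config d) : ℂ := C.value s C.out

def numNodes (_C : ArithCircuit d V) : ℕ := Fintype.card V

def numEdges : ℕ := C.edges.card

/-- The maximal length of a directed path that ends at the output. -/
def depth : ℕ := C.height C.out

open Classical in
/-- The maximum of `1` and of the moduli of all parameters of the circuit. -/
def wMax : ℝ :=
  ((max 1 ((C.edges.filter fun e => C.kind e.2 = NodeKind.sum).sup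
    fun e => ‖C.weight e.1 e.2‖₊) : ℝ≥0) : ℝ)

/-- The infimum over all configurations of `min {|Re f|, |Im f|}`. -/
def fMin : ℝ := ⨅ s : Config d, min |(C.eval s).re| |(C.eval s).im|

end ArithCircuit

def softplus (x : ℝ) : ℝ := Real.log (Real.exp x + 1)

/-- A feed-forward network with softplus activations, real parameters, and two outputs, which are
roots of its graph. If `input v = some ⟨i, k⟩`, then `v` is the input node `𝟙[s_i = k]`; all other
nodes are neurons. Roots, and only they, may use the identity instead of softplus. -/
structure SoftplusNet {N : ℕ} (d : Fin N → ℕ) (V : Type) [Fintype V] extends DAG V where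
  input : V → Option ((i : Fin N) × Fin (d i))
  input_leaf : ∀ u v, (input v).isSome → (u, v) ∉ edges
  weight : V → V → ℝ
  bias : V → ℝ
  idNodes : Set V
  idNodes_root : ∀ v ∈ idNodes, toDAG.IsRoot v
  out : Fin 2 → V
  out_injective : Function.Injective out
  out_root : ∀ j, toDAG.IsRoot (out j)

namespace SoftplusNet

variable {N : ℕ} {d : Fin N → ℕ} {V : Type} [Fintype V] (A : SoftplusNet d V)

open Classical in
/-- The activation function of a node. -/
def act (v : V) (x : ℝ) : ℝ := if v ∈ A.idNodes then x else softplus x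

/-- The value of a node at the configuration `s`. -/
def value (s : Config d) : V → ℝ :=
  A.wf.fix fun v rec =>
    match A.input v with
    | some ⟨i, k⟩ => if s i = k then 1 else 0
    | none => A.act v
        (A.bias v + ∑ u ∈ (A.preds v).attach, A.weight u.1 v * rec u.1 (A.mem_preds.1 u.2))

theorem value_eq (s : Config d) (v : V) :
    A.value s v =
      match A.input v with
      | some ⟨i, k⟩ => if s i = k then 1 else 0
      | none => A.act v (A.bias v + ∑ u ∈ A.preds v, A.weight u v * A.value s u) := by
  rw [value, WellFounded.fix_eq]
  cases A.input v with
  | some p => rfl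
  | none =>
    exact congrArg (fun t => A.act v (A.bias v + t))
      (Finset.sum_attach (A.preds v) fun u => A.weight u v * A.value s u)

/-- The function `g = (g₁, g₂)` described by the network; its components are indexed by `0, 1`. -/
def eval (s : Config d) (j : Fin 2) : ℝ := A.value s (A.out j)

def numNodes (_A : SoftplusNet d V) : ℕ := Fintype.card V

def numEdges : ℕ := A.edges.card

/-- The maximal length of a directed path that ends at one of the two outputs. -/
def depth : ℕ := max (A.height (A.out 0)) (A.height (A.out 1))

end SoftplusNet

/-- The expression `ln²((m/ε) ln(W/f)) + ln(1/ε) √(1/ε)`. -/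
def overhead (ε : ℝ) (m : ℕ) (W f : ℝ) : ℝ :=
  (Real.log ((m : ℝ) / ε * Real.log (W / f))) ^ 2 + Real.log (1 / ε) * √(1 / ε)

end

/-! Since the configuration space is finite and the required error bound is strict, it suffices to
produce a fixed graph whose weights depend on `n` and whose outputs converge pointwise to a function
closer than `ε` to the logarithm; one large `n` then serves all configurations. No error propagation
is needed: `Lim` treats limits as exact values. Inner nodes may not use the identity, so a value `F`
is carried by the two neurons `softplus F` and `softplus (-F)`, whose difference is `F`.

In the limit, a constant number of neurons gives affine maps, products (second differences of
softplus at `0`, with polarization) and step functions away from their jump. So the circuit is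
evaluated gate by gate, with products of many factors arranged as balanced binary trees; this costs
`O(m)` nodes and edges and `O(l ln m + 1)` depth (`exists_built_eval`).

The logarithm comes from bisection (`exists_bisection`). For a number `ρ * exp (θ * g)` with `θ` in
an interval of length `α`, an affine test decides whether `θ` exceeds a threshold `a`; if so, `a` is
moved from `θ` to an accumulator and the number is multiplied by `exp (-a * g)`. With `g = I` this
gives the argument, with `g = 1` applied to a multiple of the squared modulus it gives the
log-modulus. The interval shrinks by `2/3` per step, so the number of steps is logarithmic in its
initial length over `ε'`.

That length is controlled by a bound for `|log ‖f‖|`: from below by `f'`, from above because `‖f‖ ≤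
(m W)^e` with `e` the smaller of `(m+1)^l` and `2^m`. The number of steps is thus `O(c + log e)`. As
`log e` is at most `m` and `O(l ln m + 1)`, it is absorbed both in the size and in the depth. -/

noncomputable section

open Filter Topology

/-! ### Networks assembled node by node -/

/-- A softplus network without designated outputs, together with an upper bound `rank` for the
heights and with the values of the nodes. -/
structure PreNet {N : ℕ} (d : Fin N → ℕ) (U : Type) [Fintype U] where
  edges : Finset (U × U)
  rank : U → ℕ
  rank_lt : ∀ u v, (u, v) ∈ edges → rank u < rank v
  input : U → Option ((i : Fin N) × Fin (d i))
  input_leaf : ∀ u v, (input v).isSome → (u, v) ∉ edges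
  weight : U → U → ℝ
  bias : U → ℝ
  idNodes : Set U
  idNodes_root : ∀ v ∈ idNodes, ∀ w, (v, w) ∉ edges
  val : Config d → U → ℝ
  val_input : ∀ s v p, input v = some p → val s v = if s p.1 = p.2 then 1 else 0
  val_id : ∀ s v, input v = none → v ∈ idNodes →
    val s v = bias v + ∑ u, open Classical in if (u, v) ∈ edges then weight u v * val s u else 0
  val_softplus : ∀ s v, input v = none → v ∉ idNodes →
    val s v = softplus
      (bias v + ∑ u, open Classical in if (u, v) ∈ edges then weight u v * val s u else 0)

namespace PreNet

variable {N : ℕ} {d : Fin N → ℕ} {U : Type} [Fintype U]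

/-- The network without nodes. -/
def empty (d : Fin N → ℕ) : PreNet d Empty where
  edges := ∅
  rank := Empty.elim
  rank_lt := fun u => u.elim
  input := Empty.elim
  input_leaf := fun u => u.elim
  weight := fun u => u.elim
  bias := Empty.elim
  idNodes := ∅
  idNodes_root := fun u => u.elim
  val := fun _ => Empty.elim
  val_input := fun _ u => u.elim
  val_id := fun _ u => u.elim
  val_softplus := fun _ u => u.elim

/-- The parameters of a node to be added to a network. -/
structure NewNode (P : PreNet d U) where
  preds : Finset U
  rank : ℕ
  rank_lt : ∀ u ∈ preds, P.rank u < rank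
  not_id : ∀ u ∈ preds, u ∉ P.idNodes
  input : Option ((i : Fin N) × Fin (d i))
  input_leaf : input.isSome → preds = ∅
  weight : U → ℝ
  bias : ℝ
  isId : Prop

open Classical in
/-- The edges after a node has been added. -/
def addEdges {U : Type} (E : Finset (U × U)) (T : Finset U) : Finset (Option U × Option U) :=
  E.image (fun e => (some e.1, some e.2)) ∪ T.image (fun u => (some u, none))

section

variable {U : Type}

theorem some_some_mem {E : Finset (U × U)} {T : Finset U} {u v : U} :
    (some u, some v) ∈ addEdges E T ↔ (u, v) ∈ E := by
  simp [addEdges]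

theorem some_none_mem {E : Finset (U × U)} {T : Finset U} {u : U} :
    (some u, none) ∈ addEdges E T ↔ u ∈ T := by
  simp [addEdges]

theorem none_notMem {E : Finset (U × U)} {T : Finset U} {v : Option U} :
    (none, v) ∉ addEdges E T := by
  simp [addEdges]

theorem card_addEdges (E : Finset (U × U)) (T : Finset U) :
    (addEdges E T).card ≤ E.card + T.card := by
  classical
  unfold addEdges
  exact (Finset.card_union_le _ _).trans
    (add_le_add Finset.card_image_le Finset.card_image_le)

end

theorem sum_old (E : Finset (U × U)) (T : Finset U) (v : U) (g : U → ℝ)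
    [∀ u, Decidable ((some u, some v) ∈ addEdges E T)] [∀ u, Decidable ((u, v) ∈ E)] :
    (∑ u, if (some u, some v) ∈ addEdges E T then g u else 0) =
      ∑ u, if (u, v) ∈ E then g u else 0 :=
  Finset.sum_congr rfl fun _ _ => if_congr some_some_mem rfl rfl

theorem sum_new (E : Finset (U × U)) (T : Finset U) (g : U → ℝ)
    [∀ u, Decidable ((some u, none) ∈ addEdges E T)] :
    (∑ u, if (some u, none) ∈ addEdges E T then g u else 0) = ∑ u ∈ T, g u := by
  rw [← Finset.sum_filter]
  congr 1
  ext u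
  simp [some_none_mem]

variable (P : PreNet d U) (x : P.NewNode)

open Classical in
/-- The value of a new node. -/
def NewNode.val {P : PreNet d U} (x : P.NewNode) (s : Config d) : ℝ :=
  match x.input with
  | some p => if s p.1 = p.2 then 1 else 0
  | none => if x.isId then x.bias + ∑ u ∈ x.preds, x.weight u * P.val s u
      else softplus (x.bias + ∑ u ∈ x.preds, x.weight u * P.val s u)

/-- Adding a node to a network. -/
def add : PreNet d (Option U) where
  edges := addEdges P.edges x.preds
  rank := fun u => u.elim x.rank P.rank
  rank_lt := by
    rintro (_ | u) (_ | v) h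
    · exact absurd h none_notMem
    · exact absurd h none_notMem
    · exact x.rank_lt u (some_none_mem.1 h)
    · exact P.rank_lt u v (some_some_mem.1 h)
  input := fun u => u.elim x.input P.input
  input_leaf := by
    rintro (_ | u) (_ | v) h h'
    · exact none_notMem h'
    · exact none_notMem h'
    · have := x.input_leaf h
      have h2 := some_none_mem.1 h'
      simp [this] at h2
    · exact P.input_leaf u v h (some_some_mem.1 h')
  weight := fun u v => u.elim 0 fun u => v.elim (x.weight u) (P.weight u)
  bias := fun u => u.elim x.bias P.bias
  idNodes := {u | u.elim x.isId (· ∈ P.idNodes)}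
  idNodes_root := by
    rintro (_ | u) hu (_ | w) h
    · exact none_notMem h
    · exact none_notMem h
    · exact x.not_id u (some_none_mem.1 h) hu
    · exact P.idNodes_root u hu w (some_some_mem.1 h)
  val := fun s u => u.elim (x.val s) (P.val s)
  val_input := by
    rintro s (_ | u) p h
    · have h : x.input = some p := h
      simp [NewNode.val, h]
    · exact P.val_input s u p h
  val_id := by
    classical
    rintro s (_ | u) h h'
    · have h : x.input = none := h
      have h' : x.isId := h'
      simp [NewNode.val, h, h', Fintype.sum_option, none_notMem]
      convert (sum_new P.edges x.preds _).symm
    · simp only [Fintype.sum_option, none_notMem, if_false, zero_add, Option.elim_some]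
      refine (P.val_id s u h h').trans ?_
      congr 1
      convert (sum_old P.edges x.preds u _).symm
  val_softplus := by
    classical
    rintro s (_ | u) h h'
    · have h : x.input = none := h
      have h' : ¬ x.isId := h'
      simp [NewNode.val, h, h', Fintype.sum_option, none_notMem]
      congr 2
      convert (sum_new P.edges x.preds _).symm
    · simp only [Fintype.sum_option, none_notMem, if_false, zero_add, Option.elim_some]
      refine (P.val_softplus s u h h').trans ?_
      congr 2
      convert (sum_old P.edges x.preds u _).symm

/-- The underlying graph. -/
def toDAG : DAG U where
  edges := P.edges
  acyclic := by
    intro v hv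
    have h : ∀ a b, Relation.TransGen (fun u v => (u, v) ∈ P.edges) a b → P.rank a < P.rank b := by
      intro a b hab
      induction hab with
      | single h => exact P.rank_lt _ _ h
      | tail _ h ih => exact ih.trans (P.rank_lt _ _ h)
    exact lt_irrefl _ (h v v hv)

/-- The network with the given outputs. -/
def toNet (out : Fin 2 → U) (inj : Function.Injective out) (root : ∀ j, out j ∈ P.idNodes) :
    SoftplusNet d U where
  toDAG := P.toDAG
  input := P.input
  input_leaf := P.input_leaf
  weight := P.weight
  bias := P.bias
  idNodes := P.idNodes
  idNodes_root := P.idNodes_root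
  out := out
  out_injective := inj
  out_root := fun j => P.idNodes_root _ (root j)

theorem height_le (v : U) : P.toDAG.height v ≤ P.rank v := by
  induction v using P.toDAG.wf.induction with
  | _ v ih =>
    rw [DAG.height_eq]
    refine Finset.sup_le fun u hu => ?_
    have hu := P.toDAG.mem_preds.1 hu
    exact (Nat.succ_le_succ (ih u hu)).trans (P.rank_lt u v hu)

theorem value_toNet (out : Fin 2 → U) (inj : Function.Injective out)
    (root : ∀ j, out j ∈ P.idNodes) (s : Config d) (v : U) :
    (P.toNet out inj root).value s v = P.val s v := by
  classical
  induction v using P.toDAG.wf.induction with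
  | _ v ih =>
    have hsum : ∑ u ∈ (P.toNet out inj root).preds v, P.weight u v *
          (P.toNet out inj root).value s u =
        ∑ u, if (u, v) ∈ P.edges then P.weight u v * P.val s u else 0 := by
      rw [← Finset.sum_filter]
      refine Finset.sum_congr ?_ fun u hu => ?_
      · ext u
        rw [DAG.mem_preds, Finset.mem_filter]
        exact (and_iff_right (Finset.mem_univ u)).symm
      · rw [ih u (Finset.mem_filter.1 hu).2]
    rw [SoftplusNet.value_eq]
    rcases hi : P.input v with _ | p
    · have h1 : (P.toNet out inj root).input v = none := hi
      rw [h1]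
      change SoftplusNet.act _ v (P.bias v + ∑ u ∈ (P.toNet out inj root).preds v, P.weight u v *
          (P.toNet out inj root).value s u) = _
      rw [hsum]
      by_cases hv : v ∈ P.idNodes
      · rw [P.val_id s v hi hv]
        exact if_pos hv
      · rw [P.val_softplus s v hi hv]
        exact if_neg hv
    · have h1 : (P.toNet out inj root).input v = some p := hi
      rw [h1, P.val_input s v p hi]

end PreNet

/-! ### Sequences of networks with a common graph -/

/-- A node of a sequence of networks with a common graph: its values, and a bound for its height. -/
abbrev NodeSeq {N : ℕ} (d : Fin N → ℕ) : Type := (ℕ → Config d → ℝ) × ℕ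

/-- `Built S c` holds if the node sequences in `S` are nodes of a sequence of networks with a
common graph, which has at most `c` nodes and at most `c` edges. -/
inductive Built {N : ℕ} {d : Fin N → ℕ} : Set (NodeSeq d) → ℕ → Prop
  | empty : Built ∅ 0
  | input {S : Set (NodeSeq d)} {c : ℕ} (h : Built S c) (i : Fin N) (k : Fin (d i)) :
      Built (insert (fun _ s => if s i = k then 1 else 0, 0) S) (c + 1)
  | mono {S : Set (NodeSeq d)} {c c' : ℕ} (h : Built S c) (hc : c ≤ c') : Built S c'
  | neuron {S : Set (NodeSeq d)} {c : ℕ} (h : Built S c) (ι : Type) [Fintype ι]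
      (p : ι → NodeSeq d) (hp : ∀ i, p i ∈ S) (w : ℕ → ι → ℝ) (b : ℕ → ℝ) (H : ℕ)
      (hH : ∀ i, (p i).2 < H) :
      Built (insert (fun n s => softplus (b n + ∑ i, w n i * (p i).1 n s), H) S)
        (c + 1 + Fintype.card ι)

namespace Built

variable {N : ℕ} {d : Fin N → ℕ} {S : Set (NodeSeq d)} {c : ℕ}


/-- Adding a node which is a neuron or an output to the network. -/
theorem exists_add {U : Type} [Fintype U] (P : PreNet d U) {ι : Type} [Fintype ι] (u : ι → U)
    (hu : ∀ i, u i ∉ P.idNodes) (w : ι → ℝ) (b : ℝ) (H : ℕ) (hH : ∀ i, P.rank (u i) < H)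
    (isId : Prop) [Decidable isId] :
    ∃ Q : PreNet d (Option U),
      Q.edges.card ≤ P.edges.card + Fintype.card ι ∧
      (∀ v, Q.rank (some v) = P.rank v) ∧ Q.rank none = H ∧
      (∀ v, some v ∈ Q.idNodes ↔ v ∈ P.idNodes) ∧ (none ∈ Q.idNodes ↔ isId) ∧
      (∀ s v, Q.val s (some v) = P.val s v) ∧
      ∀ s, Q.val s none = if isId then b + ∑ i, w i * P.val s (u i)
        else softplus (b + ∑ i, w i * P.val s (u i)) := by
  classical
  let x : P.NewNode :=
    { preds := Finset.univ.image u
      rank := H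
      rank_lt := by simpa using hH
      not_id := by simpa using hu
      input := none
      input_leaf := by simp
      -- The family `u` may repeat a node, but the graph has no multiple edges, so the weights of
      -- repetitions are added.
      weight := fun v => ∑ i with u i = v, w i
      bias := b
      isId := isId }
  have hx : ∀ s, ∑ v ∈ x.preds, x.weight v * P.val s v = ∑ i, w i * P.val s (u i) := by
    intro s
    rw [← Finset.sum_fiberwise_of_maps_to (t := Finset.univ.image u) (g := u)
      (fun i _ => Finset.mem_image_of_mem u (Finset.mem_univ i))]
    refine Finset.sum_congr rfl fun v _ => ?_
    rw [Finset.sum_mul]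
    refine Finset.sum_congr rfl fun i hi => ?_
    rw [(Finset.mem_filter.1 hi).2]
  refine ⟨P.add x, ?_, fun v => rfl, rfl, fun v => Iff.rfl, Iff.rfl, fun s v => rfl, fun s => ?_⟩
  · exact (PreNet.card_addEdges _ _).trans
      (Nat.add_le_add_left (Finset.card_image_le.trans_eq Finset.card_univ) _)
  · change x.val s = _
    simp only [PreNet.NewNode.val, x]
    have := hx s
    simp only [x] at this
    rw [this]

/-- The graph in `Built` does not depend on `n`, so fixing `n` gives a single network. It has no
identity nodes yet, hence every node may still feed further ones. -/
theorem exists_preNet (h : Built S c) (n : ℕ) :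
    ∃ (U : Type) (_ : Fintype U) (P : PreNet d U), Fintype.card U ≤ c ∧ P.edges.card ≤ c ∧
      P.idNodes = ∅ ∧ ∀ p ∈ S, ∃ u, P.rank u = p.2 ∧ ∀ s, P.val s u = p.1 n s := by
  induction h with
  | empty => exact ⟨Empty, inferInstance, PreNet.empty d, by simp, by simp [PreNet.empty], rfl,
      by simp⟩
  | @input S c h i k ih =>
    obtain ⟨U, _, P, h1, h2, h3, h4⟩ := ih
    let x : P.NewNode :=
      { preds := ∅
        rank := 0
        rank_lt := by simp
        not_id := by simp
        input := some ⟨i, k⟩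
        input_leaf := by simp
        weight := 0
        bias := 0
        isId := False }
    refine ⟨Option U, inferInstance, P.add x, by simpa using h1, ?_, ?_, ?_⟩
    · refine (PreNet.card_addEdges _ _).trans ?_
      simp only [x, Finset.card_empty]
      omega
    · ext (_ | u)
      · exact Iff.rfl
      · change u ∈ P.idNodes ↔ some u ∈ (∅ : Set (Option U))
        simp [h3]
    · rintro p (rfl | hp)
      · exact ⟨none, rfl, fun s => rfl⟩
      · obtain ⟨u, hu⟩ := h4 p hp
        exact ⟨some u, hu⟩
  | mono h hc ih =>
    obtain ⟨U, _, P, h1, h2, h3⟩ := ih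
    exact ⟨U, inferInstance, P, h1.trans hc, h2.trans hc, h3⟩
  | @neuron S c h ι _ p hp w b H hH ih =>
    obtain ⟨U, _, P, h1, h2, h3, h4⟩ := ih
    choose u hu hu' using fun i => h4 (p i) (hp i)
    obtain ⟨Q, q1, q2, q3, q4, q5, q6, q7⟩ := exists_add P u (by simp [h3]) (w n) (b n) H
      (fun i => (hu i).trans_lt (hH i)) False
    refine ⟨Option U, inferInstance, Q, ?_, by omega, ?_, ?_⟩
    · rw [Fintype.card_option]
      omega
    · ext (_ | v)
      · simp [q5]
      · simp [q4, h3]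
    · rintro p (rfl | hp)
      · exact ⟨none, q3, fun s => by simp [q7, hu']⟩
      · obtain ⟨v, hv, hv'⟩ := h4 p hp
        exact ⟨some v, (q2 v).trans hv, fun s => (q6 s v).trans (hv' s)⟩

/-- Realization of two linear combinations of nodes as the outputs of a network. -/
theorem exists_net (h : Built S c) (n H : ℕ) (p : Fin 2 → Fin 2 → NodeSeq d)
    (hp : ∀ j i, p j i ∈ S) (hH : ∀ j i, (p j i).2 < H) :
    ∃ (U : Type) (_ : Fintype U) (A : SoftplusNet d U), A.numNodes ≤ c + 2 ∧
      A.numEdges ≤ c + 4 ∧ A.depth ≤ H ∧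
      ∀ s j, A.eval s j = (p j 0).1 n s - (p j 1).1 n s := by
  obtain ⟨U, _, P, h1, h2, h3, h4⟩ := h.exists_preNet n
  choose u hu hu' using fun j i => h4 (p j i) (hp j i)
  obtain ⟨Q, q1, q2, q3, q4, q5, q6, q7⟩ := exists_add P (u 0) (by simp [h3]) ![1, -1] 0 H
    (fun i => (hu 0 i).trans_lt (hH 0 i)) True
  obtain ⟨R, r1, r2, r3, r4, r5, r6, r7⟩ := exists_add Q (fun i => some (u 1 i))
    (by simp [q4, h3]) ![1, -1] 0 H
    (fun i => ((q2 _).trans (hu 1 i)).trans_lt (hH 1 i)) True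
  have hroot : ∀ j, (![some none, none] : Fin 2 → Option (Option U)) j ∈ R.idNodes := by
    intro j
    fin_cases j
    · simp [r4, q5]
    · simp [r5]
  have hinj : Function.Injective (![some none, none] : Fin 2 → Option (Option U)) := by
    intro i j
    fin_cases i <;> fin_cases j <;> simp
  refine ⟨Option (Option U), inferInstance, R.toNet _ hinj hroot, ?_, ?_, ?_, ?_⟩
  · simp only [SoftplusNet.numNodes, Fintype.card_option]
    omega
  · change R.edges.card ≤ _
    simp only [Fintype.card_fin] at q1 r1
    omega
  · refine max_le ((R.height_le _).trans ?_) ((R.height_le _).trans ?_)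
    · exact ((r2 none).trans q3).le
    · exact r3.le
  · intro s j
    rw [SoftplusNet.eval, PreNet.value_toNet]
    fin_cases j
    · change R.val s (some none) = _
      rw [r6, q7]
      simp [Fin.sum_univ_two, hu']
      ring
    · change R.val s none = _
      rw [r7]
      simp [Fin.sum_univ_two, hu', q6]
      ring

end Built

/-! ### Steps, squares and products as limits of softplus -/

theorem softplus_sub_softplus_neg (x : ℝ) : softplus x - softplus (-x) = x := by
  have h : Real.exp x + 1 = Real.exp x * (Real.exp (-x) + 1) := by
    rw [mul_add, ← Real.exp_add]
    simp [add_comm]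
  rw [softplus, softplus, h, Real.log_mul (Real.exp_pos _).ne' (by positivity), Real.log_exp]
  ring

theorem tendsto_softplus_atBot : Tendsto softplus atBot (𝓝 0) := by
  have h : Tendsto (fun x => Real.log (Real.exp x + 1)) atBot (𝓝 (Real.log (0 + 1))) :=
    (Real.tendsto_exp_atBot.add_const 1).log (by norm_num)
  simp only [zero_add, Real.log_one] at h
  exact h

/-- A difference of two softplus functions which tends to a step function. -/
theorem tendsto_step {a : ℕ → ℝ} {A : ℝ} (ha : Tendsto a atTop (𝓝 A)) (hA : A ≠ 0) :
    Tendsto (fun n : ℕ => softplus (n * a n + 1) - softplus (n * a n)) atTop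
      (𝓝 (if 0 < A then 1 else 0)) := by
  rcases hA.lt_or_gt with h | h
  · have h1 : Tendsto (fun n : ℕ => (n : ℝ) * a n) atTop atBot :=
      tendsto_natCast_atTop_atTop.atTop_mul_neg h ha
    have h2 := (tendsto_softplus_atBot.comp (tendsto_atBot_add_const_right _ 1 h1)).sub
      (tendsto_softplus_atBot.comp h1)
    simpa [h.not_gt] using h2
  · have h1 : Tendsto (fun n : ℕ => -((n : ℝ) * a n)) atTop atBot :=
      tendsto_neg_atTop_atBot.comp (tendsto_natCast_atTop_atTop.atTop_mul_pos h ha)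
    have h2 := ((tendsto_softplus_atBot.comp (tendsto_atBot_add_const_right _ (-1) h1)).sub
      (tendsto_softplus_atBot.comp h1)).add_const 1
    simp only [h, if_true]
    simp only [sub_zero, zero_add] at h2
    refine h2.congr fun n => ?_
    have e1 := softplus_sub_softplus_neg (n * a n + 1)
    have e2 := softplus_sub_softplus_neg (n * a n)
    simp only [Function.comp]
    rw [show -((n : ℝ) * a n) + -1 = -(n * a n + 1) by ring]
    linarith

/-- From `(e^x + 1)(e^(-x) + 1) = (2 cosh (x/2))^2`; it reduces the second difference of softplus to
bounds for `cosh`. -/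
theorem softplus_add_softplus_neg (x : ℝ) :
    softplus x + softplus (-x) = 2 * Real.log 2 + 2 * Real.log (Real.cosh (x / 2)) := by
  have h : (Real.exp x + 1) * (Real.exp (-x) + 1) = (2 * Real.cosh (x / 2)) ^ 2 := by
    rw [Real.cosh_eq]
    have e1 : Real.exp x = Real.exp (x / 2) ^ 2 := by rw [← Real.exp_nat_mul]; congr 1; push_cast; ring
    have e2 : Real.exp (-x) = Real.exp (-(x / 2)) ^ 2 := by
      rw [← Real.exp_nat_mul]; congr 1; push_cast; ring
    have e3 : Real.exp (x / 2) * Real.exp (-(x / 2)) = 1 := by rw [← Real.exp_add]; simp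
    rw [e1, e2]
    linear_combination (Real.exp (x / 2) * Real.exp (-(x / 2)) - 1) * e3
  rw [softplus, softplus, ← Real.log_mul (by positivity) (by positivity), h, Real.log_pow,
    Real.log_mul (by norm_num) (Real.cosh_pos _).ne']
  push_cast
  ring

theorem one_add_sq_half_le_cosh (x : ℝ) : 1 + x ^ 2 / 2 ≤ Real.cosh x := by
  have h1 : Real.cosh x = 1 + 2 * Real.sinh (x / 2) ^ 2 := by
    have h2 := Real.cosh_two_mul (x / 2)
    have h3 := Real.cosh_sq (x / 2)
    rw [mul_div_cancel₀ x two_ne_zero] at h2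
    linarith
  have h4 : (x / 2) ^ 2 ≤ Real.sinh (x / 2) ^ 2 := by
    rw [sq_le_sq]
    rcases le_total 0 (x / 2) with h | h
    · rw [abs_of_nonneg h, abs_of_nonneg (Real.sinh_nonneg_iff.2 h)]
      exact Real.self_le_sinh_iff.2 h
    · rw [abs_of_nonpos h, abs_of_nonpos (Real.sinh_nonpos_iff.2 h)]
      exact neg_le_neg (Real.sinh_le_self_iff.2 h)
  rw [h1]
  nlinarith

/-- The square function as a limit of second differences of softplus. -/
theorem tendsto_square {a : ℕ → ℝ} {A : ℝ} (ha : Tendsto a atTop (𝓝 A)) :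
    Tendsto (fun n : ℕ => (n : ℝ) ^ 2 *
      (softplus (a n / n) + softplus (-(a n / n)) - 2 * Real.log 2)) atTop (𝓝 (A ^ 2 / 4)) := by
  have hs : Tendsto (fun n : ℕ => a n / n / 2) atTop (𝓝 0) := by
    simpa using (ha.div_atTop tendsto_natCast_atTop_atTop).div_const 2
  have hup : Tendsto (fun n => a n ^ 2 / 4) atTop (𝓝 (A ^ 2 / 4)) := (ha.pow 2).div_const 4
  have hlow : Tendsto (fun n : ℕ => a n ^ 2 / 4 / (1 + (a n / n / 2) ^ 2 / 2)) atTop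
      (𝓝 (A ^ 2 / 4)) := by
    have := hup.div (((hs.pow 2).div_const 2).const_add 1) (by norm_num)
    simp only [ne_eq, OfNat.ofNat_ne_zero, not_false_eq_true, zero_pow, zero_div, add_zero,
      div_one] at this
    exact this
  -- The lower bound uses `1 + x²/2 ≤ cosh x` and `1 - 1/y ≤ log y`, the upper bound `cosh x ≤ exp
  -- (x²/2)`.
  refine tendsto_of_tendsto_of_tendsto_of_le_of_le' hlow hup ?_ ?_
  · filter_upwards [eventually_gt_atTop 0] with n hn
    have hn : (0 : ℝ) < n := by exact_mod_cast hn
    have h1 := one_add_sq_half_le_cosh (a n / n / 2)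
    have h2 := Real.one_sub_inv_le_log_of_pos (x := 1 + (a n / n / 2) ^ 2 / 2) (by positivity)
    have h3 := Real.log_le_log (by positivity) h1
    have h4 := h2.trans h3
    rw [softplus_add_softplus_neg]
    have h5 : a n ^ 2 / 4 / (1 + (a n / n / 2) ^ 2 / 2) =
        (n : ℝ) ^ 2 * (2 * (1 - (1 + (a n / n / 2) ^ 2 / 2)⁻¹)) := by
      have : (1 + (a n / n / 2) ^ 2 / 2) ≠ 0 := by positivity
      rw [show 1 - (1 + (a n / n / 2) ^ 2 / 2)⁻¹ =
        ((a n / n / 2) ^ 2 / 2) / (1 + (a n / n / 2) ^ 2 / 2) by field_simp; ring]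
      rw [mul_div_assoc', mul_div_assoc']
      congr 1
      field_simp
      ring
    rw [h5]
    have := mul_le_mul_of_nonneg_left h4 (by positivity : (0 : ℝ) ≤ n ^ 2 * 2)
    nlinarith
  · filter_upwards [eventually_gt_atTop 0] with n hn
    have hn : (0 : ℝ) < n := by exact_mod_cast hn
    have h1 := Real.log_le_log (Real.cosh_pos _) (Real.cosh_le_exp_half_sq (a n / n / 2))
    rw [Real.log_exp] at h1
    rw [softplus_add_softplus_neg]
    have := mul_le_mul_of_nonneg_left h1 (by positivity : (0 : ℝ) ≤ n ^ 2 * 2)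
    have e : (n : ℝ) ^ 2 * 2 * ((a n / n / 2) ^ 2 / 2) = a n ^ 2 / 4 := by
      field_simp
      ring
    rw [e] at this
    linarith

/-- Polarization `AB = ((A + B)² - (A - B)²)/4`; the constants `2 log 2` cancel. -/
theorem tendsto_product {a b : ℕ → ℝ} {A B : ℝ} (ha : Tendsto a atTop (𝓝 A))
    (hb : Tendsto b atTop (𝓝 B)) :
    Tendsto (fun n : ℕ => (n : ℝ) ^ 2 *
      (softplus ((a n + b n) / n) + softplus (-((a n + b n) / n)) -
        (softplus ((a n - b n) / n) + softplus (-((a n - b n) / n))))) atTop (𝓝 (A * B)) := by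
  have h := (tendsto_square (ha.add hb)).sub (tendsto_square (ha.sub hb))
  rw [show (A + B) ^ 2 / 4 - (A - B) ^ 2 / 4 = A * B by ring] at h
  refine h.congr fun n => ?_
  ring

/-! ### Operations on limits: real case -/

/-- `Lim S A h`: the function `A` is a limit of functions that are represented by two nodes in `S`
of height at most `h`. -/
def Lim {N : ℕ} {d : Fin N → ℕ} (S : Set (NodeSeq d)) (A : Config d → ℝ) (h : ℕ) : Prop :=
  ∃ F : ℕ → Config d → ℝ, (∀ s, Tendsto (fun n => F n s) atTop (𝓝 (A s))) ∧
    ∃ k₁ ≤ h, ∃ k₂ ≤ h, (fun n s => softplus (F n s), k₁) ∈ S ∧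
      (fun n s => softplus (-F n s), k₂) ∈ S

section

variable {N : ℕ} {d : Fin N → ℕ} {S S' : Set (NodeSeq d)} {c h h' : ℕ} {A B : Config d → ℝ}

theorem Lim.mono (hA : Lim S A h) (hS : S ⊆ S') (hh : h ≤ h') : Lim S' A h' := by
  obtain ⟨F, hF, k₁, h₁, k₂, h₂, m₁, m₂⟩ := hA
  exact ⟨F, hF, k₁, h₁.trans hh, k₂, h₂.trans hh, hS m₁, hS m₂⟩

/-- Neurons applied to an affine function of represented functions and of nodes. -/
theorem Built.exists_neuron (hS : Built S c) {ι κ : Type} [Fintype ι] [Fintype κ]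
    (F : ι → ℕ → Config d → ℝ)
    (hF : ∀ i, ∃ k₁ ≤ h, ∃ k₂ ≤ h, (fun n s => softplus (F i n s), k₁) ∈ S ∧
      (fun n s => softplus (-F i n s), k₂) ∈ S)
    (Y : κ → ℕ → Config d → ℝ) (hY : ∀ j, ∃ k ≤ h, (Y j, k) ∈ S)
    (b : ℕ → ℝ) (w : ℕ → ι → ℝ) (v : ℕ → κ → ℝ) :
    Built (insert (fun n s =>
      softplus (b n + (∑ i, w n i * F i n s + ∑ j, v n j * Y j n s)), h + 1) S)
      (c + (1 + 2 * Fintype.card ι + Fintype.card κ)) := by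
  choose k₁ h₁ k₂ h₂ m₁ m₂ using hF
  choose k hk m using hY
  have := hS.neuron ((ι ⊕ ι) ⊕ κ)
    (Sum.elim (Sum.elim (fun i => (fun n s => softplus (F i n s), k₁ i))
      (fun i => (fun n s => softplus (-F i n s), k₂ i))) (fun j => (Y j, k j)))
    (by rintro ((i | i) | j) <;> simp [*])
    (fun n => Sum.elim (Sum.elim (w n) (-w n)) (v n)) b (h + 1)
    (by rintro ((i | i) | j) <;> simp [*])
  convert this using 1
  · congr 2
    ext n s
    congr 2
    simp only [Fintype.sum_sum_type, Sum.elim_inl, Sum.elim_inr, ← Finset.sum_add_distrib]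
    congr 1
    refine Finset.sum_congr rfl fun i _ => ?_
    conv_lhs => rw [← softplus_sub_softplus_neg (F i n s)]
    simp only [Pi.neg_apply]
    ring
  · simp only [Fintype.card_sum]
    ring

theorem Built.exists_neurons (hS : Built S c) {ι : Type} [Fintype ι]
    (F : ι → ℕ → Config d → ℝ)
    (hF : ∀ i, ∃ k₁ ≤ h, ∃ k₂ ≤ h, (fun n s => softplus (F i n s), k₁) ∈ S ∧
      (fun n s => softplus (-F i n s), k₂) ∈ S) (q : ℕ)
    (b : ℕ → Fin q → ℝ) (w : ℕ → Fin q → ι → ℝ) :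
    ∃ S', S ⊆ S' ∧ Built S' (c + q * (1 + 2 * Fintype.card ι)) ∧
      ∀ j, (fun n s => softplus (b n j + ∑ i, w n j i * F i n s), h + 1) ∈ S' := by
  induction q with
  | zero => exact ⟨S, subset_rfl, by simpa using hS, fun j => j.elim0⟩
  | succ q ih =>
    obtain ⟨S', hS', hB, hm⟩ := ih (fun n j => b n j.castSucc) (fun n j => w n j.castSucc)
    have := hB.exists_neuron (h := h) (κ := Empty) F
      (fun i => by
        obtain ⟨k₁, h₁, k₂, h₂, m₁, m₂⟩ := hF i
        exact ⟨k₁, h₁, k₂, h₂, hS' m₁, hS' m₂⟩) (fun j => j.elim) (fun j => j.elim)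
      (fun n => b n (Fin.last q)) (fun n => w n (Fin.last q)) (fun _ j => j.elim)
    refine ⟨_, hS'.trans (Set.subset_insert _ _), this.mono (le_of_eq ?_), ?_⟩
    · simp only [Fintype.card_empty]
      ring
    · intro j
      refine Fin.lastCases ?_ (fun j => ?_) j
      · left
        simp
      · right
        exact hm j

/-- Functions that are limits of networks with a single hidden layer. -/
theorem Built.exists_lim (hS : Built S c) {ι : Type} [Fintype ι] (A : ι → Config d → ℝ)
    (hA : ∀ i, Lim S (A i) h) (q : ℕ) (b : ℕ → Fin q → ℝ) (w : ℕ → Fin q → ι → ℝ)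
    (b' : ℕ → ℝ) (u : ℕ → ι → ℝ) (v : ℕ → Fin q → ℝ)
    (hconv : ∀ s, ∀ a : ι → ℕ → ℝ, (∀ i, Tendsto (a i) atTop (𝓝 (A i s))) →
      Tendsto (fun n => b' n + (∑ i, u n i * a i n +
        ∑ j, v n j * softplus (b n j + ∑ i, w n j i * a i n))) atTop (𝓝 (B s))) :
    ∃ S', S ⊆ S' ∧ Built S' (c + (q * (1 + 2 * Fintype.card ι) + 2 * (1 + 2 * Fintype.card ι + q))) ∧
      Lim S' B (h + 2) := by
  choose F hF hF' using hA
  obtain ⟨S₁, hS₁, hB₁, hm⟩ := hS.exists_neurons F hF' q b w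
  have hF₁ : ∀ i, ∃ k₁ ≤ h + 1, ∃ k₂ ≤ h + 1, (fun n s => softplus (F i n s), k₁) ∈ S₁ ∧
      (fun n s => softplus (-F i n s), k₂) ∈ S₁ := fun i => by
    obtain ⟨k₁, h₁, k₂, h₂, m₁, m₂⟩ := hF' i
    exact ⟨k₁, by omega, k₂, by omega, hS₁ m₁, hS₁ m₂⟩
  set Y : Fin q → ℕ → Config d → ℝ :=
    fun j n s => softplus (b n j + ∑ i, w n j i * F i n s) with hY
  have hB₂ := hB₁.exists_neuron F hF₁ Y (fun j => ⟨h + 1, le_rfl, hm j⟩) b' u v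
  -- The same pre-activation with the opposite sign supplies the second half of the pair that `Lim`
  -- requires.
  have hB₃ := hB₂.exists_neuron F
    (fun i => by
      obtain ⟨k₁, h₁, k₂, h₂, m₁, m₂⟩ := hF₁ i
      exact ⟨k₁, h₁, k₂, h₂, Set.mem_insert_of_mem _ m₁, Set.mem_insert_of_mem _ m₂⟩)
    Y (fun j => ⟨h + 1, le_rfl, Set.mem_insert_of_mem _ (hm j)⟩) (-b') (-u) (-v)
  refine ⟨_, hS₁.trans ((Set.subset_insert _ _).trans (Set.subset_insert _ _)), hB₃.mono (le_of_eq ?_),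
    fun n s => b' n + (∑ i, u n i * F i n s + ∑ j, v n j * Y j n s),
    fun s => hconv s (fun i n => F i n s) (fun i => hF i s), h + 2, le_rfl, h + 2, le_rfl, ?_, ?_⟩
  · simp only [Fintype.card_fin]
    ring
  · right; left; rfl
  · left
    congr 1
    ext n s
    congr 1
    simp only [Pi.neg_apply, neg_mul, Finset.sum_neg_distrib]
    ring

theorem Built.exists_affine (hS : Built S c) {ι : Type} [Fintype ι] {A : ι → Config d → ℝ}
    (hA : ∀ i, Lim S (A i) h) (b : ℝ) (u : ι → ℝ) :
    ∃ S', S ⊆ S' ∧ Built S' (c + (2 + 4 * Fintype.card ι)) ∧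
      Lim S' (fun s => b + ∑ i, u i * A i s) (h + 2) := by
  obtain ⟨S', h1, h2, h3⟩ := hS.exists_lim (B := fun s => b + ∑ i, u i * A i s) A hA 0
    (fun _ => Fin.elim0) (fun _ => Fin.elim0) (fun _ => b) (fun _ => u) (fun _ => Fin.elim0)
    (fun s a ha => by
      simp only [Finset.univ_eq_empty, Finset.sum_empty, add_zero]
      exact (tendsto_finsetSum _ fun i _ => (ha i).const_mul (u i)).const_add b)
  exact ⟨S', h1, h2.mono (le_of_eq (by ring)), h3⟩

/-- Four hidden neurons, at `±(A + B)/n` and `±(A - B)/n`, with outer weights `±n²`. -/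
theorem Built.exists_mul (hS : Built S c) (hA : Lim S A h) (hB : Lim S B h) :
    ∃ S', S ⊆ S' ∧ Built S' (c + 38) ∧ Lim S' (fun s => A s * B s) (h + 2) := by
  obtain ⟨S', h1, h2, h3⟩ := hS.exists_lim (B := fun s => A s * B s) ![A, B]
    (by intro i; fin_cases i <;> assumption) 4
    (fun _ => 0) (fun n => ![![1 / n, 1 / n], ![-1 / n, -1 / n], ![1 / n, -1 / n], ![-1 / n, 1 / n]])
    (fun _ => 0) (fun _ => 0) (fun n => ![n ^ 2, n ^ 2, -n ^ 2, -n ^ 2])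
    (fun s a ha => by
      refine (tendsto_product (ha 0) (ha 1)).congr fun n => ?_
      simp [Fin.sum_univ_four, Fin.sum_univ_two]
      ring_nf)
  exact ⟨S', h1, h2, h3⟩

/-- Nonvanishing of `A` is essential: at a zero, `n * a n` may behave arbitrarily. -/
theorem Built.exists_step (hS : Built S c) (hA : Lim S A h) (hA0 : ∀ s, A s ≠ 0) :
    ∃ S', S ⊆ S' ∧ Built S' (c + 16) ∧ Lim S' (fun s => if 0 < A s then 1 else 0) (h + 2) := by
  obtain ⟨S', h1, h2, h3⟩ := hS.exists_lim (ι := Unit) (B := fun s => if 0 < A s then 1 else 0)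
    (fun _ => A) (fun _ => hA) 2 (fun _ => ![1, 0]) (fun n _ _ => n) (fun _ => 0) (fun _ => 0)
    (fun n => ![1, -1])
    (fun s a ha => by
      refine (tendsto_step (ha ()) (hA0 s)).congr fun n => ?_
      simp [Fin.sum_univ_two]
      ring_nf)
  exact ⟨S', h1, h2, h3⟩

theorem Built.exists_const (hS : Built S c) (b : ℝ) :
    ∃ S', S ⊆ S' ∧ Built S' (c + 2) ∧ Lim S' (fun _ => b) 2 := by
  simpa using hS.exists_affine (h := 0) (ι := Empty) (A := fun i => i.elim) (fun i => i.elim) b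
    (fun i => i.elim)

theorem Built.exists_input (hS : Built S c) (i : Fin N) (k : Fin (d i)) :
    ∃ S', S ⊆ S' ∧ Built S' (c + 5) ∧ Lim S' (fun s => if s i = k then 1 else 0) 1 := by
  have h1 := hS.input i k
  have h2 := h1.neuron Unit (fun _ => _) (fun _ => Set.mem_insert _ _) (fun _ _ => 1) (fun _ => 0)
    1 (by simp)
  have h3 := h2.neuron Unit (fun _ => _)
    (fun _ => Set.mem_insert_of_mem _ (Set.mem_insert _ _)) (fun _ _ => -1) (fun _ => 0) 1 (by simp)
  refine ⟨_, ?_, h3, fun _ s => if s i = k then 1 else 0, fun s => tendsto_const_nhds, 1, le_rfl, 1,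
    le_rfl, ?_, ?_⟩
  · exact (Set.subset_insert _ _).trans ((Set.subset_insert _ _).trans (Set.subset_insert _ _))
  · right; left
    simp
  · left
    simp only [Finset.univ_unique, Finset.sum_singleton, zero_add, neg_one_mul]

end

/-! ### Operations on limits: complex case -/

/-- `CLim S z h`: the real and the imaginary part of `z` are limits of functions represented by
nodes in `S` of height at most `h`. -/
def CLim {N : ℕ} {d : Fin N → ℕ} (S : Set (NodeSeq d)) (z : Config d → ℂ) (h : ℕ) : Prop :=
  Lim S (fun s => (z s).re) h ∧ Lim S (fun s => (z s).im) h

section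

variable {N : ℕ} {d : Fin N → ℕ} {S S' : Set (NodeSeq d)} {c h h' : ℕ} {z w : Config d → ℂ}

theorem CLim.mono (hz : CLim S z h) (hS : S ⊆ S') (hh : h ≤ h') : CLim S' z h' :=
  ⟨hz.1.mono hS hh, hz.2.mono hS hh⟩

theorem Lim.congr {A B : Config d → ℝ} (hA : Lim S A h) (e : ∀ s, A s = B s) : Lim S B h :=
  funext e ▸ hA

theorem CLim.congr (hz : CLim S z h) (e : ∀ s, z s = w s) : CLim S w h :=
  funext e ▸ hz

theorem Built.exists_caffine (hS : Built S c) {ι : Type} [Fintype ι] {z : ι → Config d → ℂ}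
    (hz : ∀ i, CLim S (z i) h) (b : ℂ) (u : ι → ℂ) :
    ∃ S', S ⊆ S' ∧ Built S' (c + (4 + 16 * Fintype.card ι)) ∧
      CLim S' (fun s => b + ∑ i, u i * z i s) (h + 2) := by
  have hA : ∀ i : ι ⊕ ι, Lim S ((Sum.elim (fun i s => (z i s).re) (fun i s => (z i s).im) :
      ι ⊕ ι → Config d → ℝ) i) h := by
    rintro (i | i)
    · exact (hz i).1
    · exact (hz i).2
  obtain ⟨S₁, h1, h2, h3⟩ := hS.exists_affine hA b.re
    (Sum.elim (fun i => (u i).re) (fun i => -(u i).im))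
  obtain ⟨S₂, g1, g2, g3⟩ := h2.exists_affine (fun i => (hA i).mono h1 le_rfl) b.im
    (Sum.elim (fun i => (u i).im) (fun i => (u i).re))
  refine ⟨S₂, h1.trans g1, g2.mono (le_of_eq ?_), (h3.mono g1 le_rfl).congr fun s => ?_,
    g3.congr fun s => ?_⟩
  · rw [Fintype.card_sum]
    ring
  · simp [Fintype.sum_sum_type, sub_eq_add_neg, Finset.sum_add_distrib]
  · simp [Fintype.sum_sum_type, Finset.sum_add_distrib, add_comm]

theorem Built.exists_cmul (hS : Built S c) (hz : CLim S z h) (hw : CLim S w h) :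
    ∃ S', S ⊆ S' ∧ Built S' (c + 172) ∧ CLim S' (fun s => z s * w s) (h + 4) := by
  obtain ⟨S₁, a1, b1, c1⟩ := hS.exists_mul hz.1 hw.1
  obtain ⟨S₂, a2, b2, c2⟩ := b1.exists_mul (hz.2.mono a1 le_rfl) (hw.2.mono a1 le_rfl)
  obtain ⟨S₃, a3, b3, c3⟩ := b2.exists_mul (hz.1.mono (a1.trans a2) le_rfl)
    (hw.2.mono (a1.trans a2) le_rfl)
  obtain ⟨S₄, a4, b4, c4⟩ := b3.exists_mul (hz.2.mono (a1.trans (a2.trans a3)) le_rfl)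
    (hw.1.mono (a1.trans (a2.trans a3)) le_rfl)
  obtain ⟨S₅, a5, b5, c5⟩ := b4.exists_affine (ι := Fin 2)
    (A := ![fun s => (z s).re * (w s).re, fun s => (z s).im * (w s).im]) (h := h + 2)
    (by
      intro i
      fin_cases i
      · exact c1.mono (a2.trans (a3.trans a4)) le_rfl
      · exact c2.mono (a3.trans a4) le_rfl) 0 ![1, -1]
  obtain ⟨S₆, a6, b6, c6⟩ := b5.exists_affine (ι := Fin 2)
    (A := ![fun s => (z s).re * (w s).im, fun s => (z s).im * (w s).re]) (h := h + 2)
    (by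
      intro i
      fin_cases i
      · exact c3.mono (a4.trans a5) le_rfl
      · exact c4.mono a5 le_rfl) 0 ![1, 1]
  refine ⟨S₆, a1.trans (a2.trans (a3.trans (a4.trans (a5.trans a6)))), b6.mono ?_,
    (c5.mono a6 le_rfl).congr fun s => ?_, c6.congr fun s => ?_⟩
  -- Four real products and two linear combinations: `172 = 4 * 38 + 2 * 10`.
  · simp only [Fintype.card_fin]
    omega
  · simp [Fin.sum_univ_two, sub_eq_add_neg]
  · simp [Fin.sum_univ_two]

theorem Built.exists_cconst (hS : Built S c) (b : ℂ) :
    ∃ S', S ⊆ S' ∧ Built S' (c + 4) ∧ CLim S' (fun _ => b) 2 := by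
  simpa using hS.exists_caffine (h := 0) (ι := Empty) (z := fun i => i.elim) (fun i => i.elim) b
    (fun i => i.elim)

theorem Built.exists_cinput (hS : Built S c) (i : Fin N) (k : Fin (d i)) :
    ∃ S', S ⊆ S' ∧ Built S' (c + 7) ∧ CLim S' (fun s => if s i = k then 1 else 0) 2 := by
  obtain ⟨S₁, a1, b1, c1⟩ := hS.exists_input i k
  obtain ⟨S₂, a2, b2, c2⟩ := b1.exists_const 0
  refine ⟨S₂, a1.trans a2, b2, (c1.mono a2 one_le_two).congr fun s => ?_, c2.congr fun s => ?_⟩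
  · by_cases h : s i = k <;> simp [h]
  · by_cases h : s i = k <;> simp [h]

/-- Balanced binary tree: both halves have at most `2 ^ r` factors, so each doubling costs one
multiplication layer of height 4, and there are `T.card - 1` multiplications in all. -/
theorem Built.exists_prod_of_nonempty (hS : Built S c) {V : Type} {z : V → Config d → ℂ} (r : ℕ)
    (T : Finset V) (hT : T.Nonempty) (hr : T.card ≤ 2 ^ r) (hz : ∀ v ∈ T, CLim S (z v) h) :
    ∃ S', S ⊆ S' ∧ Built S' (c + 172 * (T.card - 1)) ∧
      CLim S' (fun s => ∏ v ∈ T, z v s) (h + 4 * r) := by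
  classical
  induction r generalizing S c T with
  | zero =>
    obtain ⟨v, rfl⟩ := Finset.card_eq_one.1 (le_antisymm hr hT.card_pos)
    exact ⟨S, subset_rfl, hS.mono (by simp), by simpa using hz v (by simp)⟩
  | succ r ih =>
    rcases Nat.eq_or_lt_of_le hT.card_pos with h1 | h1
    · obtain ⟨v, rfl⟩ := Finset.card_eq_one.1 h1.symm
      refine ⟨S, subset_rfl, hS.mono (by simp), ?_⟩
      simpa using (hz v (by simp)).mono subset_rfl (by omega)
    · obtain ⟨T₁, hT₁, hc₁⟩ := Finset.exists_subset_card_eq (s := T) (n := T.card / 2) (by omega)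
      have hc₂ : (T \ T₁).card = T.card - T.card / 2 := by
        rw [Finset.card_sdiff_of_subset hT₁, hc₁]
      rw [pow_succ] at hr
      obtain ⟨S₁, a1, b1, c1⟩ := ih hS T₁ (Finset.card_pos.1 (by omega)) (by omega)
        fun v hv => hz v (hT₁ hv)
      obtain ⟨S₂, a2, b2, c2⟩ := ih b1 (T \ T₁) (Finset.card_pos.1 (by omega)) (by omega)
        fun v hv => (hz v (Finset.sdiff_subset hv)).mono a1 le_rfl
      obtain ⟨S₃, a3, b3, c3⟩ := b2.exists_cmul (c1.mono a2 le_rfl) c2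
      refine ⟨S₃, a1.trans (a2.trans a3), b3.mono (by omega), ?_⟩
      refine (c3.mono subset_rfl (by omega)).congr fun s => ?_
      rw [mul_comm, Finset.prod_sdiff hT₁]

theorem Built.exists_prod (hS : Built S c) {V : Type} {z : V → Config d → ℂ} (r : ℕ)
    (T : Finset V) (hr : T.card ≤ 2 ^ r) (hz : ∀ v ∈ T, CLim S (z v) h) :
    ∃ S', S ⊆ S' ∧ Built S' (c + (4 + 172 * T.card)) ∧
      CLim S' (fun s => ∏ v ∈ T, z v s) (h + 4 * r + 2) := by
  rcases T.eq_empty_or_nonempty with rfl | hT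
  · obtain ⟨S', a, b, e⟩ := hS.exists_cconst 1
    exact ⟨S', a, b.mono (by simp), by simpa using e.mono subset_rfl (by omega)⟩
  · obtain ⟨S', a, b, e⟩ := hS.exists_prod_of_nonempty r T hT hr hz
    exact ⟨S', a, b.mono (by omega), e.mono subset_rfl (by omega)⟩

end

/-! ### Evaluation of the circuit -/

namespace DAG

variable {V : Type} [Fintype V] (G : DAG V)

theorem height_lt_of_mem_preds {u v : V} (hu : u ∈ G.preds v) : G.height u < G.height v := by
  rw [G.height_eq v]
  exact Nat.lt_of_succ_le (Finset.le_sup (f := fun u => G.height u + 1) hu)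

open Classical in
theorem card_preds (v : V) : (G.preds v).card = (G.edges.filter fun e => e.2 = v).card := by
  refine Finset.card_bij (fun u _ => (u, v)) ?_ ?_ ?_
  · intro u hu
    simpa using G.mem_preds.1 hu
  · intro u _ u' _ h
    simpa using h
  · rintro ⟨u, w⟩ h
    obtain ⟨h1, rfl⟩ := Finset.mem_filter.1 h
    exact ⟨u, G.mem_preds.2 h1, rfl⟩

theorem sum_card_preds_le (D : Finset V) : ∑ v ∈ D, (G.preds v).card ≤ G.edges.card := by
  classical
  rw [Finset.sum_congr rfl fun v _ => G.card_preds v]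
  calc _ ≤ ∑ v, (G.edges.filter fun e => e.2 = v).card :=
        Finset.sum_le_univ_sum_of_nonneg fun _ => Nat.zero_le _
    _ = _ := (Finset.card_eq_sum_card_fiberwise fun _ _ => Finset.mem_coe.2 (Finset.mem_univ _)).symm

/-- Induction over the sets of nodes that are closed under predecessors. -/
theorem closed_induction {motive : Finset V → Prop} (empty : motive ∅)
    (insert : ∀ (D : Finset V) (v : V) (hv : v ∉ D) (_ : ∀ u ∈ G.preds v, u ∈ D), motive D →
      motive (D.cons v hv))
    (D : Finset V) (hD : ∀ v ∈ D, ∀ u ∈ G.preds v, u ∈ D) : motive D := by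
  classical
  induction hn : D.card generalizing D with
  | zero => rwa [Finset.card_eq_zero.1 hn]
  | succ n ih =>
    -- A node of maximal height is a predecessor of no node in `D`, so the rest remains closed.
    obtain ⟨v, hv, hmax⟩ := D.exists_max_image G.height (Finset.card_pos.1 (by omega))
    have hne : ∀ w ∈ D, v ∉ G.preds w := fun w hw h =>
      (G.height_lt_of_mem_preds h).not_ge (hmax w hw)
    have h1 := insert (D.erase v) v (Finset.notMem_erase v D)
      (fun u hu => Finset.mem_erase.2 ⟨fun h => hne v hv (h ▸ hu), hD v hv u hu⟩)
      (ih (D.erase v) (fun w hw u hu => Finset.mem_erase.2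
        ⟨fun h => hne w (Finset.mem_of_mem_erase hw) (h ▸ hu),
          hD w (Finset.mem_of_mem_erase hw) u hu⟩) (by rw [Finset.card_erase_of_mem hv]; omega))
    rwa [Finset.cons_eq_insert, Finset.insert_erase hv] at h1

end DAG

namespace ArithCircuit

variable {N : ℕ} {d : Fin N → ℕ} {V : Type} [Fintype V] (C : ArithCircuit d V)

/-- Evaluation of the circuit by limits of networks. -/
theorem exists_built (r : ℕ) (hr : C.edges.card ≤ 2 ^ r) (D : Finset V)
    (hD : ∀ v ∈ D, ∀ u ∈ C.preds v, u ∈ D) :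
    ∃ S, Built S (172 * (D.card + ∑ v ∈ D, (C.preds v).card)) ∧
      ∀ v ∈ D, CLim S (fun s => C.value s v) ((4 * r + 2) * C.height v + 2) := by
  refine C.toDAG.closed_induction (motive := fun D => ∃ S,
    Built S (172 * (D.card + ∑ v ∈ D, (C.preds v).card)) ∧
      ∀ v ∈ D, CLim S (fun s => C.value s v) ((4 * r + 2) * C.height v + 2))
    ⟨∅, Built.empty, by simp⟩ ?_ D hD
  · rintro D v hv hpred ⟨S, hS, hlim⟩
    -- It is enough that each new node costs at most `172 * (1 + indegree)`.
    suffices ∃ S', S ⊆ S' ∧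
        Built S' (172 * (D.card + ∑ v ∈ D, (C.preds v).card) + 172 * (1 + (C.preds v).card)) ∧
        CLim S' (fun s => C.value s v) ((4 * r + 2) * C.height v + 2) by
      obtain ⟨S', h1, h2, h3⟩ := this
      refine ⟨S', h2.mono (le_of_eq ?_), ?_⟩
      · rw [Finset.card_cons, Finset.sum_cons]
        ring
      · intro w hw
        rcases Finset.mem_cons.1 hw with rfl | hw
        · exact h3
        · exact (hlim w hw).mono h1 le_rfl
    rcases hk : C.kind v with ⟨i, k⟩ | _ | _
    · obtain ⟨S', h1, h2, h3⟩ := hS.exists_cinput i k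
      refine ⟨S', h1, h2.mono (by omega), ?_⟩
      refine (h3.mono subset_rfl (by omega)).congr fun s => ?_
      rw [C.value_eq, hk]
    · rcases (C.preds v).eq_empty_or_nonempty with h0 | hne
      · obtain ⟨S', h1, h2, h3⟩ := hS.exists_cconst 1
        refine ⟨S', h1, h2.mono (by omega), ?_⟩
        refine (h3.mono subset_rfl (by omega)).congr fun s => ?_
        rw [C.value_eq, hk]
        simp [h0]
      · obtain ⟨u₀, hu₀⟩ := hne
        have hpos := C.height_lt_of_mem_preds hu₀
        obtain ⟨q, hq⟩ : ∃ q, C.height v = q + 1 := ⟨C.height v - 1, by omega⟩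
        obtain ⟨S', h1, h2, h3⟩ := hS.exists_prod (h := (4 * r + 2) * q + 2)
          (z := fun u s => C.value s u) r (C.preds v)
          (((Finset.single_le_sum (f := fun v => (C.preds v).card) (fun _ _ => Nat.zero_le _)
            (Finset.mem_univ v)).trans (C.sum_card_preds_le Finset.univ)).trans hr)
          (fun u hu => (hlim u (hpred u hu)).mono subset_rfl (by
            have := C.height_lt_of_mem_preds hu
            gcongr
            omega))
        refine ⟨S', h1, h2.mono (by omega), ?_⟩
        refine (h3.mono subset_rfl (by rw [hq]; linarith)).congr fun s => ?_
        rw [C.value_eq, hk]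
    · rcases (C.preds v).eq_empty_or_nonempty with h0 | hne
      · obtain ⟨S', h1, h2, h3⟩ := hS.exists_cconst 0
        refine ⟨S', h1, h2.mono (by omega), ?_⟩
        refine (h3.mono subset_rfl (by omega)).congr fun s => ?_
        rw [C.value_eq, hk]
        simp [h0]
      · obtain ⟨u₀, hu₀⟩ := hne
        have hpos := C.height_lt_of_mem_preds hu₀
        obtain ⟨q, hq⟩ : ∃ q, C.height v = q + 1 := ⟨C.height v - 1, by omega⟩
        obtain ⟨S', h1, h2, h3⟩ := hS.exists_caffine (h := (4 * r + 2) * q + 2) (ι := C.preds v)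
          (z := fun u s => C.value s u)
          (fun u => (hlim u (hpred u u.2)).mono subset_rfl (by
            have := C.height_lt_of_mem_preds u.2
            gcongr
            omega)) 0 (fun u => C.weight u v)
        refine ⟨S', h1, h2.mono (by rw [Fintype.card_coe]; omega), ?_⟩
        refine (h3.mono subset_rfl (by rw [hq]; linarith)).congr fun s => ?_
        rw [C.value_eq, hk, zero_add]
        exact Finset.sum_coe_sort (C.preds v) fun u => C.weight u v * C.value s u

end ArithCircuit

/-! ### The logarithm by bisection -/

section

variable {N : ℕ} {d : Fin N → ℕ} {S : Set (NodeSeq d)} {c h : ℕ}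

theorem Built.exists_linear (hS : Built S c) {A B : Config d → ℝ} (hA : Lim S A h)
    (hB : Lim S B h) (p q r : ℝ) :
    ∃ S', S ⊆ S' ∧ Built S' (c + 10) ∧ Lim S' (fun s => p * A s + q * B s + r) (h + 2) := by
  obtain ⟨S', h1, h2, h3⟩ := hS.exists_affine (ι := Fin 2) (A := ![A, B])
    (by intro i; fin_cases i <;> assumption) r ![p, q]
  refine ⟨S', h1, h2.mono (by simp), h3.congr fun s => ?_⟩
  simp [Fin.sum_univ_two]
  ring

/-- Multiplying `z` by `a` and adding `b` to `y` at the configurations at which `A` is positive. -/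
theorem Built.exists_gate (hS : Built S c) {z : Config d → ℂ} {y A : Config d → ℝ}
    (hz : CLim S z h) (hy : Lim S y h) (hA : Lim S A (h + 2)) (hA0 : ∀ s, A s ≠ 0) (a : ℂ)
    (b : ℝ) :
    ∃ S', S ⊆ S' ∧ Built S' (c + 218) ∧
      CLim S' (fun s => if 0 < A s then a * z s else z s) (h + 10) ∧
      Lim S' (fun s => if 0 < A s then y s + b else y s) (h + 10) := by
  obtain ⟨S₁, a1, b1, c1⟩ := hS.exists_step hA hA0
  -- With `χ` the step function of `A`, the factor is `1 + (a - 1) χ`; this and the next line build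
  -- its real and imaginary parts.
  obtain ⟨S₂, a2, b2, c2⟩ := b1.exists_linear c1 c1 (a.re - 1) 0 1
  obtain ⟨S₃, a3, b3, c3⟩ := b2.exists_linear (c1.mono a2 le_rfl) (c1.mono a2 le_rfl) a.im 0 0
  obtain ⟨S₄, a4, b4, c4⟩ := b3.exists_cmul (h := h + 6)
    (w := fun s => if 0 < A s then a else 1)
    (hz.mono (a1.trans (a2.trans a3)) (by omega))
    ⟨(c2.mono a3 (by omega)).congr fun s => by by_cases h : 0 < A s <;> simp [h],
      (c3.mono subset_rfl (by omega)).congr fun s => by by_cases h : 0 < A s <;> simp [h]⟩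
  obtain ⟨S₅, a5, b5, c5⟩ := b4.exists_linear (h := h + 8)
    (hy.mono (a1.trans (a2.trans (a3.trans a4))) (by omega))
    (c1.mono (a2.trans (a3.trans a4)) (by omega)) 1 b 0
  refine ⟨S₅, a1.trans (a2.trans (a3.trans (a4.trans a5))), b5.mono (by omega),
    (c4.mono a5 (by omega)).congr fun s => ?_, c5.congr fun s => ?_⟩
  · split_ifs <;> simp [mul_comm]
  · split_ifs <;> simp

/-- Finitely many configurations take finitely many exponents, so a threshold can avoid them all and
the step function is never tested at its jump. -/
theorem exists_Ioo_avoiding {X : Type} [Finite X] (θ : X → ℝ) {u v : ℝ} (huv : u < v) :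
    ∃ a ∈ Set.Ioo u v, ∀ s, θ s ≠ a := by
  obtain ⟨a, ha, ha'⟩ := ((Set.Ioo_infinite huv).sdiff (Set.finite_range θ)).nonempty
  exact ⟨a, ha, fun s hs => ha' ⟨s, hs⟩⟩

/-- A bisection step for the exponent `θ` of `ρ * exp (θ * g)`. The affine functions with the
coefficients `p`, `q` and `r` decide on which side of `a` the exponent lies. -/
theorem Built.exists_bisection_step (hS : Built S c) {ρ θ y : Config d → ℝ} {g : ℂ} {α : ℝ}
    (hα : 0 < α) (p q r : ℝ → ℝ)
    (htest : ∀ s a t, 0 < a → a < α → 0 < t → t < α →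
      ((0 < p a * ((ρ s : ℂ) * Complex.exp (t * g)).re +
        q a * ((ρ s : ℂ) * Complex.exp (t * g)).im + r a ↔ a < t) ∧
      (p a * ((ρ s : ℂ) * Complex.exp (t * g)).re +
        q a * ((ρ s : ℂ) * Complex.exp (t * g)).im + r a = 0 → t = a)))
    (hθ : ∀ s, θ s ∈ Set.Ioo 0 α)
    (hz : CLim S (fun s => (ρ s : ℂ) * Complex.exp (θ s * g)) h) (hy : Lim S y h) :
    ∃ (S' : _) (θ' y' : Config d → ℝ), S ⊆ S' ∧ Built S' (c + 228) ∧
      (∀ s, θ' s ∈ Set.Ioo 0 (2 / 3 * α)) ∧ (∀ s, y' s + θ' s = y s + θ s) ∧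
      CLim S' (fun s => (ρ s : ℂ) * Complex.exp (θ' s * g)) (h + 10) ∧ Lim S' y' (h + 10) := by
  -- If `θ > a`, the remainder `θ - a` is below `α/2`; otherwise `θ < a < 2α/3`. Either way the new
  -- bound is `2α/3`.
  obtain ⟨a, ⟨ha1, ha2⟩, ha3⟩ := exists_Ioo_avoiding θ (show α / 2 < 2 / 3 * α by linarith)
  obtain ⟨S₁, a1, b1, c1⟩ := hS.exists_linear hz.1 hz.2 (p a) (q a) (r a)
  have ht := fun s => htest s a (θ s) (by linarith) (by linarith) (hθ s).1 (hθ s).2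
  obtain ⟨S₂, a2, b2, c2, d2⟩ := b1.exists_gate (hz.mono a1 le_rfl) (hy.mono a1 le_rfl) c1
    (fun s hs => ha3 s ((ht s).2 hs)) (Complex.exp (-a * g)) a
  refine ⟨S₂, fun s => if a < θ s then θ s - a else θ s, fun s => if a < θ s then y s + a else y s,
    a1.trans a2, b2.mono (by omega), fun s => ?_, fun s => ?_, c2.congr fun s => ?_,
    d2.congr fun s => ?_⟩
  · have h1 := hθ s
    have h2 := ha3 s
    rw [Set.mem_Ioo] at h1 ⊢
    dsimp only
    split_ifs with h3
    · constructor <;> linarith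
    · have h4 : θ s < a := lt_of_le_of_ne (not_lt.1 h3) h2
      constructor <;> linarith
  · dsimp only
    split_ifs <;> ring
  · simp only [(ht s).1]
    split_ifs
    · rw [mul_left_comm, ← Complex.exp_add]
      congr 2
      push_cast
      ring
    · rfl
  · simp only [(ht s).1]

/-- Each step preserves `y + θ`, so the final accumulator misses the target exactly by the remaining
exponent. -/
theorem Built.exists_bisection (hS : Built S c) {ρ θ y : Config d → ℝ} {g : ℂ} {α : ℝ}
    (hα : 0 < α) (p q r : ℝ → ℝ)
    (htest : ∀ s a t, 0 < a → a < α → 0 < t → t < α →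
      ((0 < p a * ((ρ s : ℂ) * Complex.exp (t * g)).re +
        q a * ((ρ s : ℂ) * Complex.exp (t * g)).im + r a ↔ a < t) ∧
      (p a * ((ρ s : ℂ) * Complex.exp (t * g)).re +
        q a * ((ρ s : ℂ) * Complex.exp (t * g)).im + r a = 0 → t = a)))
    (hθ : ∀ s, θ s ∈ Set.Ioo 0 α)
    (hz : CLim S (fun s => (ρ s : ℂ) * Complex.exp (θ s * g)) h) (hy : Lim S y h) (n : ℕ) :
    ∃ (S' : _) (y' : Config d → ℝ), S ⊆ S' ∧ Built S' (c + 228 * n) ∧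
      (∀ s, |y' s - (y s + θ s)| < (2 / 3) ^ n * α) ∧ Lim S' y' (h + 10 * n) := by
  suffices ∃ (S' : _) (θ' y' : Config d → ℝ), S ⊆ S' ∧ Built S' (c + 228 * n) ∧
      (∀ s, θ' s ∈ Set.Ioo 0 ((2 / 3) ^ n * α)) ∧ (∀ s, y' s + θ' s = y s + θ s) ∧
      CLim S' (fun s => (ρ s : ℂ) * Complex.exp (θ' s * g)) (h + 10 * n) ∧
      Lim S' y' (h + 10 * n) by
    obtain ⟨S', θ', y', h1, h2, h3, h4, h5, h6⟩ := this
    refine ⟨S', y', h1, h2, fun s => ?_, h6⟩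
    rw [← h4, sub_add_cancel_left, abs_neg, abs_of_pos (h3 s).1]
    exact (h3 s).2
  induction n with
  | zero => exact ⟨S, θ, y, subset_rfl, hS, by simpa using hθ, fun s => rfl, hz, hy⟩
  | succ n ih =>
    obtain ⟨S₁, θ₁, y₁, h1, h2, h3, h4, h5, h6⟩ := ih
    have hle : (2 / 3 : ℝ) ^ n * α ≤ α :=
      mul_le_of_le_one_left hα.le (pow_le_one₀ (by norm_num) (by norm_num))
    obtain ⟨S₂, θ₂, y₂, g1, g2, g3, g4, g5, g6⟩ := h2.exists_bisection_step
      (by positivity : 0 < (2 / 3 : ℝ) ^ n * α) p q r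
      (fun s a t i1 i2 i3 i4 => htest s a t i1 (i2.trans_le hle) i3 (i4.trans_le hle)) h3 h5 h6
    refine ⟨S₂, θ₂, y₂, h1.trans g1, g2.mono (by omega), fun s => ?_,
      fun s => (g4 s).trans (h4 s), g5.mono subset_rfl (by omega), g6.mono subset_rfl (by omega)⟩
    rw [pow_succ', mul_assoc]
    exact g3 s

/-- Replacing `f` by `-f` in the lower half-plane puts the angle in `(0, π)`, the endpoints being
excluded by `Im f ≠ 0`. The accumulator starts at `-π` there and at `0` elsewhere. -/
theorem Built.exists_arg (hS : Built S c) {f : Config d → ℂ} (hf : CLim S f h) (h2 : 2 ≤ h)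
    (him : ∀ s, (f s).im ≠ 0) (n : ℕ) :
    ∃ (S' : _) (y : Config d → ℝ), S ⊆ S' ∧ Built S' (c + 230 + 228 * n) ∧
      (∀ s, |y s - (f s).arg| < (2 / 3) ^ n * Real.pi) ∧ Lim S' y (h + 10 + 10 * n) := by
  obtain ⟨S₁, a1, b1, c1⟩ := hS.exists_const 0
  obtain ⟨S₂, a2, b2, c2⟩ := b1.exists_linear (hf.2.mono a1 le_rfl) (hf.2.mono a1 le_rfl) (-1) 0 0
  obtain ⟨S₃, a3, b3, c3, d3⟩ := b2.exists_gate (hf.mono (a1.trans a2) le_rfl) (c1.mono a2 h2) c2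
    (fun s => by simpa using him s) (-1) (-Real.pi)
  have hsign : ∀ s, (0 < -1 * (f s).im + 0 * (f s).im + 0 ↔ (f s).im < 0) := fun s => by
    rw [show -1 * (f s).im + 0 * (f s).im + 0 = -(f s).im by ring]
    exact neg_pos
  have hne : ∀ s, f s ≠ 0 := fun s hs => him s (by simp [hs])
  obtain ⟨S₄, y, a4, b4, c4, d4⟩ := b3.exists_bisection (ρ := fun s => ‖f s‖)
    (θ := fun s => if (f s).im < 0 then (f s).arg + Real.pi else (f s).arg) (g := Complex.I)
    Real.pi_pos (fun a => -Real.sin a) Real.cos (fun _ => 0) (by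
      intro s a t i1 i2 i3 i4
      -- The test is a rotation by `-a`: it yields `‖f‖ sin (t - a)`, and `t - a` lies in `(-π, π)`,
      -- where sine has the sign of its argument.
      have e : -Real.sin a * ((‖f s‖ : ℂ) * Complex.exp (t * Complex.I)).re +
          Real.cos a * ((‖f s‖ : ℂ) * Complex.exp (t * Complex.I)).im + 0 =
          ‖f s‖ * Real.sin (t - a) := by
        rw [Complex.re_ofReal_mul, Complex.im_ofReal_mul, Complex.exp_ofReal_mul_I_re,
          Complex.exp_ofReal_mul_I_im, Real.sin_sub]
        ring
      rw [e]
      have hn := norm_pos_iff.2 (hne s)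
      constructor
      · rw [mul_pos_iff_of_pos_left hn]
        constructor
        · intro hp
          by_contra hle
          have := Real.sin_nonpos_of_nonpos_of_neg_pi_le (x := t - a) (by linarith) (by linarith)
          linarith
        · intro hlt
          exact Real.sin_pos_of_pos_of_lt_pi (by linarith) (by linarith)
      · intro h0
        have h1 : Real.sin (t - a) = 0 := by
          rcases mul_eq_zero.1 h0 with h | h
          · exact absurd h hn.ne'
          · exact h
        have := (Real.sin_eq_zero_iff_of_lt_of_lt (by linarith) (by linarith)).1 h1
        linarith)
    (by
      intro s
      have hlow := Complex.neg_pi_lt_arg (f s)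
      split_ifs with hs
      · have := Complex.arg_neg_iff.2 hs
        constructor <;> linarith
      · have hpos : 0 < (f s).im := lt_of_le_of_ne (not_lt.1 hs) (him s).symm
        have h0 := Complex.arg_nonneg_iff.2 hpos.le
        refine ⟨lt_of_le_of_ne h0 fun e => ?_, lt_of_le_of_ne (Complex.arg_le_pi _) fun e => ?_⟩
        · exact him s (Complex.arg_eq_zero_iff.1 e.symm).2
        · exact him s (Complex.arg_eq_pi_iff.1 e).2)
    (c3.congr fun s => by
      simp only [hsign s]
      split_ifs
      · rw [Complex.ofReal_add, add_mul, Complex.exp_add, Complex.exp_pi_mul_I, ← mul_assoc,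
          Complex.norm_mul_exp_arg_mul_I]
        ring
      · rw [Complex.norm_mul_exp_arg_mul_I]) d3 n
  refine ⟨S₄, y, a1.trans (a2.trans (a3.trans a4)), b4.mono (by omega), fun s => ?_, d4⟩
  convert c4 s using 3
  simp only [hsign s]
  split_ifs <;> ring

/-- The squared modulus is polynomial in the real and imaginary parts. Scaled by `exp (2R)` it
equals `exp θ` with `θ = 2R + 2 log ‖f‖` in `(0, 4R)`; the accumulator starts at `-2R` and is halved
at the end. -/
theorem Built.exists_log_norm (hS : Built S c) {f : Config d → ℂ} (hf : CLim S f h) (h2 : 2 ≤ h)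
    (hne : ∀ s, f s ≠ 0) {R : ℝ} (hR : ∀ s, |Real.log ‖f s‖| < R) (hR0 : 0 < R) (n : ℕ) :
    ∃ (S' : _) (y : Config d → ℝ), S ⊆ S' ∧ Built S' (c + 100 + 228 * n) ∧
      (∀ s, |y s - Real.log ‖f s‖| < (2 / 3) ^ n * (2 * R)) ∧ Lim S' y (h + 6 + 10 * n) := by
  obtain ⟨S₁, a1, b1, c1⟩ := hS.exists_const 0
  obtain ⟨S₂, a2, b2, c2⟩ := b1.exists_mul (hf.1.mono a1 le_rfl) (hf.1.mono a1 le_rfl)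
  obtain ⟨S₃, a3, b3, c3⟩ := b2.exists_mul (hf.2.mono (a1.trans a2) le_rfl)
    (hf.2.mono (a1.trans a2) le_rfl)
  obtain ⟨S₄, a4, b4, c4⟩ := b3.exists_linear (c2.mono a3 le_rfl) c3 (Real.exp (2 * R))
    (Real.exp (2 * R)) 0
  obtain ⟨S₅, a5, b5, c5⟩ := b4.exists_const (-(2 * R))
  obtain ⟨S₆, y, a6, b6, c6, d6⟩ := b5.exists_bisection (h := h + 4) (α := 4 * R)
    (ρ := fun _ => 1) (θ := fun s => 2 * R + 2 * Real.log ‖f s‖) (g := 1)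
    (by positivity) (fun _ => 1) (fun _ => 0) (fun a => -Real.exp a) (by
      intro s a t i1 i2 i3 i4
      have e : 1 * (((1 : ℝ) : ℂ) * Complex.exp (t * 1)).re +
          0 * (((1 : ℝ) : ℂ) * Complex.exp (t * 1)).im + -Real.exp a =
          Real.exp t - Real.exp a := by
        simp [← Complex.ofReal_exp, sub_eq_add_neg]
      rw [e, sub_pos, sub_eq_zero, Real.exp_lt_exp]
      exact ⟨Iff.rfl, fun h => Real.exp_injective h⟩)
    (by
      intro s
      have := abs_lt.1 (hR s)
      constructor <;> linarith)
    (by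
      have e : ∀ s, ((1 : ℝ) : ℂ) *
          Complex.exp ((2 * R + 2 * Real.log ‖f s‖ : ℝ) * 1) =
          ((Real.exp (2 * R) * ((f s).re * (f s).re) + Real.exp (2 * R) * ((f s).im * (f s).im) + 0
            : ℝ) : ℂ) := by
        intro s
        have hn := norm_pos_iff.2 (hne s)
        rw [Complex.ofReal_one, one_mul, mul_one, ← Complex.ofReal_exp, Real.exp_add,
          mul_comm 2 (Real.log _), Real.exp_mul (Real.log _) 2, Real.exp_log hn]
        congr 1
        rw [Real.rpow_two, ← Complex.normSq_eq_norm_sq, Complex.normSq_apply]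
        ring
      exact ⟨(c4.mono a5 le_rfl).congr fun s =>
          ((congrArg Complex.re (e s)).trans (Complex.ofReal_re _)).symm,
        (c1.mono (a2.trans (a3.trans (a4.trans a5))) (by omega)).congr fun s =>
          ((congrArg Complex.im (e s)).trans (Complex.ofReal_im _)).symm⟩) (c5.mono subset_rfl (by omega)) n
  obtain ⟨S₇, a7, b7, c7⟩ := b6.exists_linear d6 d6 (1 / 2) 0 0
  refine ⟨S₇, _, a1.trans (a2.trans (a3.trans (a4.trans (a5.trans (a6.trans a7))))),
    b7.mono (by omega), fun s => ?_, c7.mono subset_rfl (by omega)⟩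
  have := c6 s
  rw [abs_lt] at this ⊢
  constructor <;> linarith [this.1, this.2]

/-- Two represented functions as the outputs of a network, up to an arbitrarily small error. -/
theorem Built.exists_net_of_lim (hS : Built S c) {A B : Config d → ℝ} (hA : Lim S A h)
    (hB : Lim S B h) {w : Config d → ℂ} {ε : ℝ}
    (hw : ∀ s, ‖((A s : ℂ) + Complex.I * (B s : ℂ)) - w s‖ < ε) :
    ∃ (U : Type) (_ : Fintype U) (G : SoftplusNet d U), G.numNodes ≤ c + 2 ∧
      G.numEdges ≤ c + 4 ∧ G.depth ≤ h + 1 ∧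
      ∀ s, ‖((G.eval s 0 : ℂ) + Complex.I * (G.eval s 1 : ℂ)) - w s‖ < ε := by
  obtain ⟨F, hF, k₁, h₁, k₂, h₂, m₁, m₂⟩ := hA
  obtain ⟨F', hF', k₁', h₁', k₂', h₂', m₁', m₂'⟩ := hB
  -- Finiteness of the configuration space lets one `n` work for every `s`.
  have hev : ∀ᶠ n in atTop, ∀ s, ‖((F n s : ℂ) + Complex.I * (F' n s : ℂ)) - w s‖ < ε := by
    rw [eventually_all]
    intro s
    have h1 : Tendsto (fun n => ‖((F n s : ℂ) + Complex.I * (F' n s : ℂ)) - w s‖) atTop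
        (𝓝 ‖((A s : ℂ) + Complex.I * (B s : ℂ)) - w s‖) :=
      ((((Complex.continuous_ofReal.tendsto _).comp (hF s)).add
        (((Complex.continuous_ofReal.tendsto _).comp (hF' s)).const_mul _)).sub_const _).norm
    exact h1.eventually (gt_mem_nhds (hw s))
  obtain ⟨n, hn⟩ := hev.exists
  obtain ⟨U, _, G, g1, g2, g3, g4⟩ := hS.exists_net n (h + 1)
    ![![(fun n s => softplus (F n s), k₁), (fun n s => softplus (-F n s), k₂)],
      ![(fun n s => softplus (F' n s), k₁'), (fun n s => softplus (-F' n s), k₂')]]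
    (by intro j i; fin_cases j <;> fin_cases i <;> assumption)
    (by intro j i; fin_cases j <;> fin_cases i <;> simp <;> omega)
  refine ⟨U, inferInstance, G, g1, g2, g3, fun s => ?_⟩
  have e0 : G.eval s 0 = F n s := (g4 s 0).trans (softplus_sub_softplus_neg _)
  have e1 : G.eval s 1 = F' n s := (g4 s 1).trans (softplus_sub_softplus_neg _)
  rw [e0, e1]
  exact hn s

/-- Approximation of the logarithm of a represented function. -/
theorem Built.exists_net_log (hS : Built S c) {f : Config d → ℂ} (hf : CLim S f h) (h2 : 2 ≤ h)
    (him : ∀ s, (f s).im ≠ 0) {R : ℝ} (hR : ∀ s, |Real.log ‖f s‖| < R) (hR1 : 1 ≤ R) (n : ℕ) :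
    ∃ (U : Type) (_ : Fintype U) (G : SoftplusNet d U), G.numNodes ≤ c + 340 + 456 * n ∧
      G.numEdges ≤ c + 340 + 456 * n ∧ G.depth ≤ h + 11 + 10 * n ∧
      ∀ s, ‖((G.eval s 0 : ℂ) + Complex.I * (G.eval s 1 : ℂ)) - Complex.log (f s)‖ <
        (2 / 3) ^ n * (6 * R) := by
  have hne : ∀ s, f s ≠ 0 := fun s hs => him s (by simp [hs])
  obtain ⟨S₁, y₁, a1, b1, c1, d1⟩ := hS.exists_log_norm hf h2 hne hR (by linarith) n
  obtain ⟨S₂, y₂, a2, b2, c2, d2⟩ := b1.exists_arg (hf.mono a1 le_rfl) h2 him n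
  obtain ⟨U, i, G, g1, g2, g3, g4⟩ := b2.exists_net_of_lim (h := h + 10 + 10 * n)
    (d1.mono a2 (by omega)) d2 (w := fun s => Complex.log (f s)) (ε := (2 / 3) ^ n * (6 * R)) (by
      intro s
      have e : ((y₁ s : ℂ) + Complex.I * (y₂ s : ℂ)) - Complex.log (f s) =
          ((y₁ s - Real.log ‖f s‖ : ℝ) : ℂ) + Complex.I * ((y₂ s - (f s).arg : ℝ) : ℂ) := by
        rw [Complex.log]
        push_cast
        ring
      rw [e]
      refine (norm_add_le _ _).trans_lt ?_
      rw [norm_mul, Complex.norm_I, one_mul, Complex.norm_real, Complex.norm_real,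
        Real.norm_eq_abs, Real.norm_eq_abs]
      have hpi := Real.pi_lt_four
      -- The errors `2R` and `π ≤ 4R`, both times `(2/3)^n`, add up to the factor `6R`.
      have h1 := c1 s
      have h2 := c2 s
      have h3 : (2 / 3 : ℝ) ^ n * Real.pi ≤ (2 / 3) ^ n * (4 * R) := by gcongr; linarith
      linarith)
  exact ⟨U, i, G, by omega, by omega, by omega, g4⟩

end

/-! ### Growth bounds for the circuit -/

namespace ArithCircuit

variable {N : ℕ} {d : Fin N → ℕ} {V : Type} [Fintype V] (C : ArithCircuit d V)

theorem one_le_wMax : 1 ≤ C.wMax := by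
  unfold wMax
  exact_mod_cast le_max_left _ _

theorem norm_weight_le {u v : V} (hu : u ∈ C.preds v) (hv : C.kind v = NodeKind.sum) :
    ‖C.weight u v‖ ≤ C.wMax := by
  classical
  have h : ‖C.weight u v‖₊ ≤ (C.edges.filter fun e => C.kind e.2 = NodeKind.sum).sup
      fun e => ‖C.weight e.1 e.2‖₊ :=
    Finset.le_sup (f := fun e : V × V => ‖C.weight e.1 e.2‖₊)
      (b := (u, v)) (Finset.mem_filter.2 ⟨C.mem_preds.1 hu, hv⟩)
  have h' := h.trans (le_max_right 1 _)
  unfold wMax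
  convert NNReal.coe_le_coe.2 h' using 1
  exact (coe_nnnorm _).symm

theorem card_preds_le (v : V) : (C.preds v).card ≤ C.numEdges :=
  (Finset.single_le_sum (f := fun v => (C.preds v).card) (fun _ _ => Nat.zero_le _)
    (Finset.mem_univ v)).trans (C.sum_card_preds_le Finset.univ)

/-- Bookkeeping for one node: a product multiplies the exponent by at most the in-degree, a weighted
sum costs one further factor `Q`. -/
theorem norm_value_le_pow (s : Config d) {Q : ℝ} (hQ1 : 1 ≤ Q) (hQ : C.numEdges * C.wMax ≤ Q)
    (v : V) (e E : ℕ) (he : ∀ u ∈ C.preds v, ‖C.value s u‖ ≤ Q ^ e)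
    (h1 : e * (C.preds v).card ≤ E) (h2 : (C.preds v).Nonempty → e + 1 ≤ E) :
    ‖C.value s v‖ ≤ Q ^ E := by
  have hE : 1 ≤ Q ^ E := one_le_pow₀ hQ1
  rw [C.value_eq]
  rcases hk : C.kind v with ⟨i, k⟩ | _ | _
  · dsimp only
    split_ifs <;> simp <;> linarith
  · dsimp only
    rw [norm_prod]
    calc ∏ u ∈ C.preds v, ‖C.value s u‖ ≤ ∏ _u ∈ C.preds v, Q ^ e :=
          Finset.prod_le_prod (fun _ _ => norm_nonneg _) he
      _ = Q ^ (e * (C.preds v).card) := by rw [Finset.prod_const, pow_mul]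
      _ ≤ Q ^ E := pow_le_pow_right₀ hQ1 h1
  · dsimp only
    rcases (C.preds v).eq_empty_or_nonempty with h0 | hne
    · rw [h0, Finset.sum_empty, norm_zero]
      linarith
    · have hW := C.one_le_wMax
      calc ‖∑ u ∈ C.preds v, C.weight u v * C.value s u‖
          ≤ ∑ _u ∈ C.preds v, C.wMax * Q ^ e := by
            refine norm_sum_le_of_le _ fun u hu => ?_
            rw [norm_mul]
            exact mul_le_mul (C.norm_weight_le hu hk) (he u hu) (norm_nonneg _) (by linarith)
        _ = (C.preds v).card * C.wMax * Q ^ e := by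
            rw [Finset.sum_const, nsmul_eq_mul, mul_assoc]
        _ ≤ C.numEdges * C.wMax * Q ^ e := by
            have := C.card_preds_le v
            gcongr
        _ ≤ Q * Q ^ e := by gcongr
        _ = Q ^ (e + 1) := (pow_succ' Q e).symm
        _ ≤ Q ^ E := pow_le_pow_right₀ hQ1 (h2 hne)

/-- Each level multiplies the exponent by at most `m` or adds one, hence by at most the factor `m +
1` in either case. -/
theorem norm_value_le_of_height (s : Config d) {Q : ℝ} (hQ1 : 1 ≤ Q)
    (hQ : C.numEdges * C.wMax ≤ Q) (v : V) :
    ‖C.value s v‖ ≤ Q ^ ((C.numEdges + 1) ^ C.height v) := by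
  induction v using C.toDAG.wf.induction with
  | _ v ih =>
    refine C.norm_value_le_pow s hQ1 hQ v ((C.numEdges + 1) ^ (C.height v - 1)) _ ?_ ?_ ?_
    · intro u hu
      refine (ih u (C.mem_preds.1 hu)).trans (pow_le_pow_right₀ hQ1 ?_)
      have := C.height_lt_of_mem_preds hu
      exact Nat.pow_le_pow_right (Nat.succ_pos _) (by omega)
    · rcases (C.preds v).eq_empty_or_nonempty with h0 | ⟨u, hu⟩
      · simp [h0]
      · have := C.height_lt_of_mem_preds hu
        obtain ⟨q, hq⟩ : ∃ q, C.height v = q + 1 := ⟨C.height v - 1, by omega⟩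
        rw [hq, Nat.add_sub_cancel, pow_succ]
        exact Nat.mul_le_mul_left _ ((C.card_preds_le v).trans (Nat.le_succ _))
    · rintro ⟨u, hu⟩
      have h1 := C.height_lt_of_mem_preds hu
      have h2 : 0 < C.numEdges := (Finset.card_pos.2 ⟨u, hu⟩).trans_le (C.card_preds_le v)
      obtain ⟨q, hq⟩ : ∃ q, C.height v = q + 1 := ⟨C.height v - 1, by omega⟩
      rw [hq, Nat.add_sub_cancel, pow_succ]
      have h3 : 0 < (C.numEdges + 1) ^ q := by positivity
      nlinarith

/-- A node of in-degree `k` multiplies the exponent by at most `2^k`, since `k ≤ 2^k` and, for `k ≥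
1`, `e + 1 ≤ 2^k e`. Over all nodes the in-degrees sum to at most `m`. -/
theorem norm_value_le_of_closed (s : Config d) {Q : ℝ} (hQ1 : 1 ≤ Q)
    (hQ : C.numEdges * C.wMax ≤ Q) (D : Finset V) (hD : ∀ v ∈ D, ∀ u ∈ C.preds v, u ∈ D) :
    ∀ v ∈ D, ‖C.value s v‖ ≤ Q ^ (2 ^ ∑ v ∈ D, (C.preds v).card) := by
  refine C.toDAG.closed_induction
    (motive := fun D => ∀ v ∈ D, ‖C.value s v‖ ≤ Q ^ (2 ^ ∑ v ∈ D, (C.preds v).card))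
    (by simp) ?_ D hD
  intro D v hv hpred ih w hw
  rw [Finset.sum_cons, pow_add]
  set e := ∑ v ∈ D, (C.preds v).card
  have he : 0 < 2 ^ e := by positivity
  rcases Finset.mem_cons.1 hw with rfl | hw
  · refine C.norm_value_le_pow s hQ1 hQ w (2 ^ e) _ (fun u hu => ih u (hpred u hu)) ?_ ?_
    · rw [mul_comm]
      exact Nat.mul_le_mul_right _ Nat.lt_two_pow_self.le
    · intro hne
      have : 2 ^ 1 ≤ 2 ^ (C.preds w).card :=
        Nat.pow_le_pow_right two_pos (Finset.card_pos.2 hne)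
      nlinarith
  · exact (ih w hw).trans (pow_le_pow_right₀ hQ1 (Nat.le_mul_of_pos_left _ (by positivity)))

theorem height_le_numEdges (v : V) : C.height v ≤ C.numEdges := by
  refine le_trans ?_ (C.sum_card_preds_le Finset.univ)
  refine C.toDAG.closed_induction
    (motive := fun D => ∀ v ∈ D, C.height v ≤ ∑ v ∈ D, (C.preds v).card)
    (by simp) ?_ Finset.univ (fun _ _ _ _ => Finset.mem_univ _) v (Finset.mem_univ v)
  intro D v hv hpred ih w hw
  rw [Finset.sum_cons]
  rcases Finset.mem_cons.1 hw with rfl | hw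
  · rw [C.height_eq]
    refine Finset.sup_le fun u hu => ?_
    have := ih u (hpred u hu)
    have := Finset.card_pos.2 ⟨u, hu⟩
    omega
  · exact (ih w hw).trans (Nat.le_add_left _ _)

theorem log_norm_eval_le (hm : 0 < C.numEdges) (s : Config d) :
    Real.log ‖C.eval s‖ ≤ (min ((C.numEdges + 1) ^ C.depth) (2 ^ C.numEdges) : ℕ) *
      Real.log (C.numEdges * C.wMax) := by
  have hW := C.one_le_wMax
  have hm' : (1 : ℝ) ≤ C.numEdges := by exact_mod_cast hm
  have hQ : 1 ≤ C.numEdges * C.wMax := one_le_mul_of_one_le_of_one_le hm' hW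
  have h1 : ‖C.eval s‖ ≤
      (C.numEdges * C.wMax) ^ min ((C.numEdges + 1) ^ C.depth) (2 ^ C.numEdges) := by
    rcases min_choice ((C.numEdges + 1) ^ C.depth) (2 ^ C.numEdges) with h | h <;> rw [h]
    · exact C.norm_value_le_of_height s hQ le_rfl C.out
    · refine (C.norm_value_le_of_closed s hQ le_rfl Finset.univ
        (fun _ _ _ _ => Finset.mem_univ _) C.out (Finset.mem_univ _)).trans
        (pow_le_pow_right₀ hQ (Nat.pow_le_pow_right two_pos (C.sum_card_preds_le Finset.univ)))
  rw [← Real.log_pow]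
  -- At a zero of the circuit the convention `Real.log 0 = 0` makes the bound hold.
  rcases (norm_nonneg (C.eval s)).eq_or_lt with h0 | h0
  · rw [← h0, Real.log_zero]
    exact Real.log_nonneg (one_le_pow₀ hQ)
  · exact Real.log_le_log h0 h1

theorem fMin_le (s : Config d) : C.fMin ≤ min |(C.eval s).re| |(C.eval s).im| :=
  ciInf_le (Set.finite_range _).bddBelow s

/-- Without predecessors the output would be `0` or `1`, hence real, contradicting `Im f ≠ 0`. In
particular `m ≥ 1`. -/
theorem preds_out_nonempty (hf : 0 < C.fMin) : (C.preds C.out).Nonempty := by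
  by_contra h0
  rw [Finset.not_nonempty_iff_eq_empty] at h0
  -- The real infimum over an empty type is `0`, so positivity of `fMin` excludes this case.
  have hne : Nonempty (Config d) := by
    by_contra hne
    rw [not_nonempty_iff] at hne
    rw [fMin, Real.iInf_of_isEmpty] at hf
    exact lt_irrefl _ hf
  obtain ⟨s⟩ := hne
  have h1 : (C.eval s).im ≠ 0 :=
    abs_pos.1 (hf.trans_le ((C.fMin_le s).trans (min_le_right _ _)))
  apply h1
  rw [eval, C.value_eq]
  rcases hk : C.kind C.out with ⟨i, k⟩ | _ | _
  · dsimp only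
    split_ifs <;> simp
  · simp [h0]
  · simp [h0]

/-- A function given by a circuit is represented with a number of nodes and edges proportional to
the number of edges of the circuit. -/
theorem exists_built_eval (hf : 0 < C.fMin) (r : ℕ) (hr : C.numEdges ≤ 2 ^ r) :
    ∃ S, Built S (516 * C.numEdges) ∧ CLim S C.eval ((4 * r + 2) * C.depth + 2) := by
  classical
  -- Only endpoints of edges are built, at most `2m` nodes, so isolated nodes cost nothing and `516
  -- = 172 * (2 + 1)`.
  set D := C.edges.image Prod.fst ∪ C.edges.image Prod.snd with hD
  obtain ⟨S, h1, h2⟩ := C.exists_built r hr D (by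
    intro v _ u hu
    exact Finset.mem_union_left _ (Finset.mem_image_of_mem Prod.fst (C.mem_preds.1 hu)))
  refine ⟨S, h1.mono ?_, h2 C.out ?_⟩
  · have h3 : D.card ≤ C.numEdges + C.numEdges :=
      (Finset.card_union_le _ _).trans (add_le_add Finset.card_image_le Finset.card_image_le)
    have h4 : _ ≤ C.numEdges := C.sum_card_preds_le D
    omega
  · obtain ⟨u, hu⟩ := C.preds_out_nonempty hf
    exact Finset.mem_union_right _ (Finset.mem_image_of_mem Prod.snd (C.mem_preds.1 hu))

end ArithCircuit

/-! ### Numerical estimates -/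

theorem half_lt_log_two : 1 / 2 < Real.log 2 := by
  have := Real.log_two_gt_d9
  linarith

/-- `y ≤ y² + 1/4`, and the second summand of the overhead is at least `1/2` when `ε ≤ 1/2`. -/
theorem log_le_overhead {ε : ℝ} (hε : 0 < ε) (hε2 : ε ≤ 1 / 2) (m : ℕ) (W f : ℝ) :
    1 ≤ 2 * overhead ε m W f ∧
      Real.log ((m : ℝ) / ε * Real.log (W / f)) ≤ overhead ε m W f := by
  have h1 : 2 ≤ 1 / ε := by
    rw [le_div_iff₀ hε]
    linarith
  have h2 : 1 / 2 < Real.log (1 / ε) :=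
    half_lt_log_two.trans_le (Real.log_le_log (by norm_num) h1)
  have h3 : 1 ≤ √(1 / ε) := Real.one_le_sqrt.2 (by linarith)
  have h4 : 1 / 2 ≤ Real.log (1 / ε) * √(1 / ε) := by nlinarith
  unfold overhead
  set y := Real.log ((m : ℝ) / ε * Real.log (W / f))
  constructor
  · nlinarith [sq_nonneg y]
  · nlinarith [sq_nonneg (y - 1 / 2)]

/-- `r` is the binary logarithm rounded up. For `m = 1` the logarithm vanishes, and the summand 2
suffices because `l ≤ 1`. -/
theorem exists_le_two_pow {m l : ℕ} (hm : 0 < m) (hl : l ≤ m) :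
    ∃ r : ℕ, m ≤ 2 ^ r ∧ (4 * r + 2) * (l : ℝ) ≤ 20 * (l * Real.log m) + 2 := by
  rcases Nat.eq_or_lt_of_le hm with h1 | h1
  · refine ⟨0, by omega, ?_⟩
    have : (l : ℝ) ≤ 1 := by exact_mod_cast h1 ▸ hl
    rw [← h1]
    simp
    linarith
  · refine ⟨Nat.clog 2 m, Nat.le_pow_clog one_lt_two m, ?_⟩
    have h2 := Nat.pow_pred_clog_lt_self one_lt_two h1
    have h3 : 0 < Nat.clog 2 m := Nat.clog_pos one_lt_two h1
    obtain ⟨q, hq⟩ : ∃ q, Nat.clog 2 m = q + 1 := ⟨Nat.clog 2 m - 1, by omega⟩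
    rw [hq] at h2 ⊢
    have h4 : (2 : ℝ) ^ q ≤ m := by exact_mod_cast h2.le
    have h5 := Real.log_le_log (by positivity) h4
    rw [Real.log_pow] at h5
    have h6 : Real.log 2 ≤ Real.log m := Real.log_le_log two_pos (by exact_mod_cast h1)
    have h7 := half_lt_log_two
    have h8 : (q : ℝ) ≤ 2 * Real.log m := by nlinarith [(Nat.cast_nonneg q : (0 : ℝ) ≤ q)]
    have h9 : (4 * ((q + 1 : ℕ) : ℝ) + 2) ≤ 20 * Real.log m := by
      push_cast
      linarith
    have := mul_le_mul_of_nonneg_right h9 (Nat.cast_nonneg l : (0 : ℝ) ≤ l)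
    linarith

/-- The first bound serves the size, the second the depth; the latter uses `m + 1 ≤ m²`, which fails
only for `m = 1`, covered by the summand 1. -/
theorem log_min_le {m l : ℕ} (hm : 0 < m) :
    Real.log (min ((m + 1) ^ l) (2 ^ m) : ℕ) ≤ m ∧
      Real.log (min ((m + 1) ^ l) (2 ^ m) : ℕ) ≤ 2 * (l * Real.log m) + 1 := by
  have hpos : (0 : ℝ) < (min ((m + 1) ^ l) (2 ^ m) : ℕ) := by
    have : 0 < min ((m + 1) ^ l) (2 ^ m) := lt_min (by positivity) (by positivity)
    exact_mod_cast this
  have hlog2 : Real.log 2 ≤ 1 := by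
    have := Real.log_two_lt_d9
    linarith
  have h1 : Real.log (min ((m + 1) ^ l) (2 ^ m) : ℕ) ≤ m := by
    have h : ((min ((m + 1) ^ l) (2 ^ m) : ℕ) : ℝ) ≤ 2 ^ m := by
      exact_mod_cast min_le_right ((m + 1) ^ l) (2 ^ m)
    refine (Real.log_le_log hpos h).trans ?_
    rw [Real.log_pow]
    exact mul_le_of_le_one_right (Nat.cast_nonneg m) hlog2
  refine ⟨h1, ?_⟩
  rcases Nat.eq_or_lt_of_le hm with h2 | h2
  · subst h2
    simpa using h1
  · have h : ((min ((m + 1) ^ l) (2 ^ m) : ℕ) : ℝ) ≤ ((m : ℝ) ^ 2) ^ l := by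
      refine (Nat.cast_le.2 (min_le_left ((m + 1) ^ l) (2 ^ m))).trans ?_
      have : m + 1 ≤ m ^ 2 := by nlinarith
      exact_mod_cast Nat.pow_le_pow_left this l
    refine (Real.log_le_log hpos h).trans ?_
    rw [Real.log_pow, Real.log_pow]
    push_cast
    linarith

/-- `2/3 ≤ exp (-1/3)`, so `3 log (B/ε)` steps suffice. -/
theorem exists_pow_two_thirds_le {B ε : ℝ} (hB : 0 < B) (hε : 0 < ε) (h : 0 ≤ Real.log (B / ε)) :
    ∃ n : ℕ, (2 / 3 : ℝ) ^ n * B ≤ ε ∧ n ≤ 3 * Real.log (B / ε) + 1 := by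
  refine ⟨⌈3 * Real.log (B / ε)⌉₊, ?_, (Nat.ceil_lt_add_one (by linarith)).le⟩
  set n := ⌈3 * Real.log (B / ε)⌉₊
  have hn : 3 * Real.log (B / ε) ≤ n := Nat.le_ceil _
  have h1 : (2 / 3 : ℝ) ≤ Real.exp (-(1 / 3)) := by
    have := Real.add_one_le_exp (-(1 / 3) : ℝ)
    linarith
  have h2 : (2 / 3 : ℝ) ^ n ≤ Real.exp (-Real.log (B / ε)) := by
    refine (pow_le_pow_left₀ (by norm_num) h1 n).trans ?_
    rw [← Real.exp_nat_mul]
    exact Real.exp_le_exp.2 (by linarith)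
  rw [Real.exp_neg, Real.exp_log (by positivity)] at h2
  calc (2 / 3 : ℝ) ^ n * B ≤ (B / ε)⁻¹ * B := by gcongr
    _ = ε := by field_simp

end

/-! ### Conclusion -/

theorem theorem1 :
    ∃ K : ℝ, 0 < K ∧
      ∀ (N : ℕ) (d : Fin N → ℕ) (V : Type) (_ : Fintype V) (C : ArithCircuit d V) (ε : ℝ),
        0 < C.fMin → 0 < ε →
        ∃ (U : Type) (_ : Fintype U) (A : SoftplusNet d U),
          (∀ s : Config d,
            ‖((A.eval s 0 : ℂ) + Complex.I * (A.eval s 1 : ℂ)) - Complex.log (C.eval s)‖ < ε) ∧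
          (A.numNodes : ℝ) ≤ K * (C.numNodes + C.numEdges +
            overhead (min ε (1 / 2)) C.numEdges C.wMax (min C.fMin (1 / 2))) ∧
          (A.numEdges : ℝ) ≤ K * (C.numEdges +
            overhead (min ε (1 / 2)) C.numEdges C.wMax (min C.fMin (1 / 2))) ∧
          (A.depth : ℝ) ≤ K * (C.depth * Real.log C.numEdges +
            overhead (min ε (1 / 2)) C.numEdges C.wMax (min C.fMin (1 / 2))) := by
  -- The estimates below need roughly `1884 m + 11168 c` nodes or edges; the constant leaves room.
  refine ⟨20000, by norm_num, ?_⟩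
  intro N d V _ C ε hf hε
  obtain ⟨u₀, hu₀⟩ := C.preds_out_nonempty hf
  have hm : 0 < C.numEdges := (Finset.card_pos.2 ⟨u₀, hu₀⟩).trans_le (C.card_preds_le _)
  have hlm : C.depth ≤ C.numEdges := C.height_le_numEdges C.out
  have hm' : (1 : ℝ) ≤ C.numEdges := by exact_mod_cast hm
  have hW := C.one_le_wMax
  set ε' := min ε (1 / 2) with hε'
  set f' := min C.fMin (1 / 2) with hf'
  have hε0 : 0 < ε' := lt_min hε (by norm_num)
  have hf0 : 0 < f' := lt_min hf (by norm_num)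
  have hf2 : f' ≤ 1 / 2 := min_le_right _ _
  obtain ⟨hc1, hc2⟩ := log_le_overhead hε0 (min_le_right ε (1 / 2)) C.numEdges C.wMax f'
  set c := overhead ε' C.numEdges C.wMax f'
  obtain ⟨r, hr1, hr2⟩ := exists_le_two_pow hm hlm
  obtain ⟨he1, he2⟩ := log_min_le (l := C.depth) hm
  have hbound := C.log_norm_eval_le hm
  have he : (1 : ℝ) ≤ (min ((C.numEdges + 1) ^ C.depth) (2 ^ C.numEdges) : ℕ) := by
    have : 1 ≤ min ((C.numEdges + 1) ^ C.depth) (2 ^ C.numEdges) :=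
      le_min (Nat.one_le_pow _ _ (by omega)) (Nat.one_le_pow _ _ two_pos)
    exact_mod_cast this
  set e := min ((C.numEdges + 1) ^ C.depth) (2 ^ C.numEdges)
  -- `Λ` dominates both `-log f'` and `log (m W)`, so `e * Λ + 1` bounds the log-modulus on both
  -- sides.
  set Λ := C.numEdges * Real.log (C.wMax / f') with hΛ
  have hlogf : Real.log 2 ≤ -Real.log f' := by
    rw [← Real.log_inv]
    refine Real.log_le_log two_pos ?_
    rw [le_inv_comm₀ two_pos hf0]
    linarith
  have hlog2 := half_lt_log_two
  have hlogW : 0 ≤ Real.log C.wMax := Real.log_nonneg hW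
  have hdiv : Real.log (C.wMax / f') = Real.log C.wMax + -Real.log f' := by
    rw [Real.log_div (by linarith) hf0.ne', sub_eq_add_neg]
  have hΛf : -Real.log f' ≤ Λ := by
    rw [hΛ, hdiv]
    nlinarith
  have hQ : Real.log (C.numEdges * C.wMax) ≤ Λ := by
    have h1 : Real.log C.numEdges ≤ C.numEdges * Real.log 2 := by
      rw [← Real.log_pow]
      refine Real.log_le_log (by linarith) ?_
      exact_mod_cast Nat.lt_two_pow_self.le
    rw [Real.log_mul (by linarith) (by linarith), hΛ, hdiv]
    nlinarith
  have hΛ2 : 1 / 2 ≤ Λ := by linarith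
  have heΛ : Λ ≤ e * Λ := le_mul_of_one_le_left (by linarith) he
  have him : ∀ s, (C.eval s).im ≠ 0 := fun s =>
    abs_pos.1 (hf.trans_le ((C.fMin_le s).trans (min_le_right _ _)))
  have hR : ∀ s, |Real.log ‖C.eval s‖| < e * Λ + 1 := by
    intro s
    rw [abs_lt]
    constructor
    · have h1 : f' ≤ ‖C.eval s‖ := (min_le_left _ _).trans ((C.fMin_le s).trans
        ((min_le_left _ _).trans (Complex.abs_re_le_norm _)))
      have := Real.log_le_log hf0 h1
      linarith
    · have h1 := hbound s
      have h2 : (e : ℝ) * Real.log (C.numEdges * C.wMax) ≤ e * Λ := by gcongr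
      linarith
  -- The last logarithm is the one bounded by `c`; `18` arises from `6 (eΛ + 1) ≤ 18 eΛ`, valid as
  -- `eΛ ≥ 1/2`.
  have hlogB : Real.log (18 * (e * Λ) / ε') =
      Real.log 18 + Real.log e + Real.log (C.numEdges / ε' * Real.log (C.wMax / f')) := by
    rw [← Real.log_mul (by norm_num) (by linarith), ← Real.log_mul (by positivity)]
    · congr 1
      rw [hΛ]
      ring
    · have : 0 < Real.log (C.wMax / f') := by linarith
      positivity
  have hlog18 : Real.log 18 ≤ 3 := by
    rw [Real.log_le_iff_le_exp (by norm_num)]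
    have h1 := Real.exp_one_gt_d9
    have h2 : Real.exp 3 = Real.exp 1 ^ 3 := by rw [← Real.exp_nat_mul]; norm_num
    rw [h2]
    calc (18 : ℝ) ≤ 2.7 ^ 3 := by norm_num
      _ ≤ Real.exp 1 ^ 3 := by gcongr; linarith
  obtain ⟨n, hn1, hn2⟩ := exists_pow_two_thirds_le (B := 18 * (e * Λ)) (by linarith) hε0 (by
    refine Real.log_nonneg ?_
    rw [le_div_iff₀ hε0]
    have := min_le_right ε (1 / 2)
    linarith)
  obtain ⟨S, hS1, hS2⟩ := C.exists_built_eval hf r hr1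
  obtain ⟨U, i, A, hA1, hA2, hA3, hA4⟩ := hS1.exists_net_log hS2 (Nat.le_add_left _ _) him hR
    (by linarith) n
  -- `n ≤ 3 (3 + log e + c) + 1`, and `10 ≤ 20 c` because `1 ≤ 2c`.
  have hn3 : (n : ℝ) ≤ 23 * c + 3 * Real.log e := by linarith
  have hmul : (2 / 3 : ℝ) ^ n * (6 * (e * Λ + 1)) ≤ (2 / 3) ^ n * (18 * (e * Λ)) :=
    mul_le_mul_of_nonneg_left (by linarith) (by positivity)
  have hC0 : (0 : ℝ) ≤ C.numNodes := Nat.cast_nonneg _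
  have hl0 : 0 ≤ (C.depth : ℝ) * Real.log C.numEdges :=
    mul_nonneg (Nat.cast_nonneg _) (Real.log_nonneg hm')
  refine ⟨U, i, A, fun s => (hA4 s).trans_le ?_, ?_, ?_, ?_⟩
  · exact hmul.trans (hn1.trans (min_le_left _ _))
  · have h : (A.numNodes : ℝ) ≤ 516 * C.numEdges + 340 + 456 * n := by exact_mod_cast hA1
    linarith
  · have h : (A.numEdges : ℝ) ≤ 516 * C.numEdges + 340 + 456 * n := by exact_mod_cast hA2
    linarith
  · have h : (A.depth : ℝ) ≤ (4 * r + 2) * C.depth + 2 + 11 + 10 * n := by exact_mod_cast hA3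
    linarith
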